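/- Let $M$ be a connected closed $2$-dimensional surface, not necessarily orientable, and let $\Gamma$ be a triangulation of $M$, that is, a $2$-cell embedding of a connected simple finite graph in $M$ all of whose faces are triangles, such that every edge lies on precisely two distinct faces and any two distinct faces meet in an edge, in a vertex or not at all. A \emph{zigzag} of $\Gamma$ is a sequence of edges $e_1,e_2,\dots$ such that for every $i$ the edges $e_i,e_{i+1}$ are distinct edges of one face, the faces containing $e_i,e_{i+1}$ and $e_{i+1},e_{i+2}$ are distinct, and $e_i$, $e_{i+2}$ have no common vertex; such a sequence is periodic and is regarded as a cyclic sequence. A \emph{$z$-orientation} $\tau$ of $\Gamma$ is a collection of zigzags that contains, for every zigzag $Z$, exactly one of $Z$ and the reversed zigzag $Z^{-1}$; the zigzags of $\tau$ pass, altogether, exactly twice through every edge. An edge is of type I if these two passages are in different directions and of type II if they are in the same direction. A vertex is of type I if all edges containing it are of type I, and of type II otherwise. A face is of type I if two of its edges are of type I and the third one is of type II. Let $\Gamma_{II}$ be the subgraph of $\Gamma$ formed by all vertices and edges of type II, regarded as a subset of $M$. Suppose that all faces of $\Gamma$ are of type I with respect to $\tau$. Then: \begin{enumerate} \item[(1)]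 every connected component of $M\setminus\Gamma_{II}$ is homeomorphic to an open $2$-dimensional disk, an open M\"obius strip or an open cylinder; \item[(2)] a connected component of $M\setminus\Gamma_{II}$ contains a vertex of type I if and only if it is homeomorphic to an open $2$-dimensional disk, and such a component contains exactly one vertex of type I. \end{enumerate} -/

import Mathlib

/-- The geometric realization of a finite family `faces` of finite vertex sets: the points of the
standard simplex on `V` (in barycentric coordinates) that are supported on one of the sets. For a
family of 3-element sets it is a union of triangles; two of them are glued along the side,
or at the vertex, that they share. -/
def geomRealization {V : Type*} [Fintype V] (faces : Finset (Finset V)) : Set (V → ℝ) :=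
  {x | x ∈ stdSimplex ℝ V ∧ ∃ s ∈ faces, ∀ v, v ∉ s → x v = 0}

/-- A triangulation of the space `M` with finite vertex set `V`: the space `M` is presented
as a finite union of triangles whose sides are glued in pairs. The graph is simple and two distinct
faces meet in an edge, in a vertex or not at all, so that an edge is a set of two
vertices and a face is a set of three vertices. (If `M` is connected then so is the graph.) -/
structure SurfaceTriangulation (V : Type*) [Fintype V] [DecidableEq V]
    (M : Type*) [TopologicalSpace M] where
  /-- the faces, given by their vertices -/
  faces : Finset (Finset V)
  /-- all faces are triangles -/
  card_face : ∀ s ∈ faces, s.card = 3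
  /-- every vertex lies on a face -/
  exists_face : ∀ v : V, ∃ s ∈ faces, v ∈ s
  /-- every side of a triangle is glued to a side of exactly one other triangle -/
  card_faces_edge : ∀ e : Finset V, e.card = 2 → (∃ s ∈ faces, e ⊆ s) →
    (faces.filter fun s => e ⊆ s).card = 2
  /-- the triangles glued along their common sides form `M` -/
  homeo : geomRealization faces ≃ₜ M

namespace SurfaceTriangulation

variable {V : Type*} [Fintype V] [DecidableEq V] {M : Type*} [TopologicalSpace M]

/-- The edges of the triangulation: the sides of its faces. -/
def IsEdge (T : SurfaceTriangulation V M) (e : Finset V) : Prop :=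
  e.card = 2 ∧ ∃ s ∈ T.faces, e ⊆ s

theorem single_mem (T : SurfaceTriangulation V M) (v : V) :
    (Pi.single v 1 : V → ℝ) ∈ geomRealization T.faces := by
  obtain ⟨s, hs, hv⟩ := T.exists_face v
  refine ⟨single_mem_stdSimplex ℝ v, s, hs, fun w hw => ?_⟩
  have hwv : w ≠ v := fun h => hw (h ▸ hv)
  simp [hwv]

/-- The point of `M` that is the vertex `v`. -/
def vertexPoint (T : SurfaceTriangulation V M) (v : V) : M :=
  T.homeo ⟨Pi.single v 1, T.single_mem v⟩

/-- The closed arc in `M` that is the edge `e` (with its two ends). -/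
def edgeArc (T : SurfaceTriangulation V M) (e : Finset V) : Set M :=
  T.homeo '' {x | ∀ v, v ∉ e → x.1 v = 0}

/-- Zigzags. Since a zigzag is determined by any two consecutive edges, in both directions, and the
triangulation is finite, a zigzag is a periodic sequence of edges; it is indexed here by `ℤ`.
Two consecutive edges are distinct edges of a face, consecutive such faces `s`, `t` are distinct,
and the edges with indices `i` and `i + 2` have no common vertex. -/
def IsZigzag (T : SurfaceTriangulation V M) (Z : ℤ → Finset V) : Prop :=
  ∀ i : ℤ, T.IsEdge (Z i) ∧ Z i ≠ Z (i + 1) ∧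
    (∃ s ∈ T.faces, ∃ t ∈ T.faces, s ≠ t ∧
      Z i ⊆ s ∧ Z (i + 1) ⊆ s ∧ Z (i + 1) ⊆ t ∧ Z (i + 2) ⊆ t) ∧
    Disjoint (Z i) (Z (i + 2))

/-- A `z`-orientation: a collection of zigzags which contains, for every zigzag `Z`, exactly one
of `Z` and the reversed zigzag. A zigzag is a cyclic sequence, that is, a sequence up to a shift of
the index, so the collection is closed under shifts. -/
structure IsZOrientation (T : SurfaceTriangulation V M) (τ : Set (ℤ → Finset V)) : Prop where
  isZigzag : ∀ Z ∈ τ, T.IsZigzag Z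
  shift : ∀ Z ∈ τ, ∀ k : ℤ, (fun i => Z (i + k)) ∈ τ
  xor_reverse : ∀ Z, T.IsZigzag Z → Xor (Z ∈ τ) ((fun i => Z (-i)) ∈ τ)

/-- Some zigzag of the collection `τ` passes through the edge `{u, v}` in the direction
from `u` to `v`. -/
def PassesThrough (τ : Set (ℤ → Finset V)) (u v : V) : Prop :=
  ∃ Z ∈ τ, ∃ i : ℤ, Z i = {u, v} ∧ Z (i - 1) ∩ Z i = {u} ∧ Z i ∩ Z (i + 1) = {v}

/-- Edges of type I: the zigzags of `τ` pass through the edge in different directions. -/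
def IsEdgeI (T : SurfaceTriangulation V M) (τ : Set (ℤ → Finset V)) (e : Finset V) : Prop :=
  T.IsEdge e ∧ ∃ u v : V, e = {u, v} ∧ PassesThrough τ u v ∧ PassesThrough τ v u

/-- Edges of type II: the zigzags of `τ` pass through the edge in one direction only. -/
def IsEdgeII (T : SurfaceTriangulation V M) (τ : Set (ℤ → Finset V)) (e : Finset V) : Prop :=
  T.IsEdge e ∧ ¬ T.IsEdgeI τ e

/-- Vertices of type I: all edges at the vertex are of type I. -/
def IsVertexI (T : SurfaceTriangulation V M) (τ : Set (ℤ → Finset V)) (v : V) : Prop :=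
  ∀ e, T.IsEdge e → v ∈ e → T.IsEdgeI τ e

/-- Faces of type I: two edges are of type I and the third one is of type II. -/
def IsFaceI (T : SurfaceTriangulation V M) (τ : Set (ℤ → Finset V)) (s : Finset V) : Prop :=
  s ∈ T.faces ∧ ∃ a b c : V, s = {a, b, c} ∧
    T.IsEdgeI τ {a, b} ∧ T.IsEdgeI τ {a, c} ∧ T.IsEdgeII τ {b, c}

/-- The subset `Γ_II` of `M`: the union of all vertices of type II (those not of type I) and all
edges of type II. -/
def graphII (T : SurfaceTriangulation V M) (τ : Set (ℤ → Finset V)) : Set M :=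
  {p | ∃ v, ¬ T.IsVertexI τ v ∧ p = T.vertexPoint v} ∪
    {p | ∃ e, T.IsEdgeII τ e ∧ p ∈ T.edgeArc e}

end SurfaceTriangulation

/-- `C` is a connected component of the subset `A` of `M`. -/
def IsComponentOf {M : Type*} [TopologicalSpace M] (C A : Set M) : Prop :=
  ∃ x ∈ A, C = connectedComponentIn A x

/-- The open 2-dimensional disk. -/
abbrev OpenDisk : Type := Metric.ball (0 : EuclideanSpace ℝ (Fin 2)) 1

/-- The open cylinder `(-1, 1) × S¹`. -/
abbrev OpenCylinder : Type := Set.Ioo (-1 : ℝ) 1 × Circle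

/-- The open Möbius strip: `[0, 1] × (-1, 1)` with `(0, y)` glued to `(1, -y)` for all `y`,
with the quotient topology. -/
abbrev OpenMobiusStrip : Type :=
  Quot fun p q : Set.Icc (0 : ℝ) 1 × Set.Ioo (-1 : ℝ) 1 =>
    (p.1 : ℝ) = 0 ∧ (q.1 : ℝ) = 1 ∧ (q.2 : ℝ) = -(p.2 : ℝ)

/-! Every face has exactly two sides of type I, so entering a face through one of them and leaving
through the other continues uniquely in both directions. There are finitely many faces, so the walk
closes up into a cyclic strip of triangles (`IsStrip.exists_period`). Consecutive crossed edges
share a vertex, and the third side of the face between them is an edge of type II.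

The strip is the image of the rectangle [0, 1] × [-1, 1]: the crossed edges are its vertical
segments at multiples of 1/n, with linear interpolation between them (`bandPoint`). For -1 < y < 1
the only identifications glue the two ends, either straight or flipped (`IsStrip.bandPoint_eq`). The
image and the union of the remaining faces are closed and cover M; off Γ_II they do not meet, so the
image without Γ_II is a whole component (`IsStrip.exists_isQuotientMap_component`).

In a face only the apex, the common end of the two sides of type I, can be a vertex of type I. If it
is one, the walk turns around it forever, the line y = 1 collapses to it and the component is a disk
(`IsStrip.component_of_vertexI`). Otherwise both lines y = ±1 lie in Γ_II, and the component is a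
cylinder or a Möbius strip (`IsStrip.component_of_no_vertexI`). These two are not disks because
their core loop winds once around the circle (`not_exists_essential_loop`). -/

open Set Topology

/-! ### General topology: quotient maps, components, local non-separation. -/

theorem nonempty_homeomorph_of_isQuotientMap {A B C : Type*} [TopologicalSpace A]
    [TopologicalSpace B] [TopologicalSpace C] {f : A → B} {g : A → C} (hf : IsQuotientMap f)
    (hg : IsQuotientMap g) (h : ∀ a a', f a = f a' ↔ g a = g a') : Nonempty (B ≃ₜ C) := by
  have hk : Setoid.ker f = Setoid.ker g := by
    ext a a'
    exact h a a'
  have e := IsQuotientMap.homeomorph (f := ⟨f, hf.continuous⟩) hf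
  have e' := IsQuotientMap.homeomorph (f := ⟨g, hg.continuous⟩) hg
  change Quotient (Setoid.ker f) ≃ₜ B at e
  rw [hk] at e
  exact ⟨e.symm.trans e'⟩

/-- A continuous map from a compact space to a Hausdorff space restricts to a quotient map over any
subset of its range. -/
theorem isQuotientMap_codRestrict {A B D : Type*} [TopologicalSpace A] [CompactSpace A]
    [TopologicalSpace B] [T2Space B] [TopologicalSpace D] {F : A → B} (hF : Continuous F)
    {j : D → A} (hj : IsEmbedding j) {s : Set B} (hr : range j = F ⁻¹' s) (hs : s ⊆ range F)
    (hm : ∀ d, F (j d) ∈ s) : IsQuotientMap (fun d => (⟨F (j d), hm d⟩ : s)) := by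
  have hc : Continuous (fun d => (⟨F (j d), hm d⟩ : s)) :=
    (hF.comp hj.continuous).subtype_mk _
  refine IsClosedMap.isQuotientMap ?_ hc ?_
  · intro t ht
    obtain ⟨u, hu, rfl⟩ := hj.isInducing.isClosed_iff.1 ht
    have : (fun d => (⟨F (j d), hm d⟩ : s)) '' (j ⁻¹' u) = Subtype.val ⁻¹' (F '' u) := by
      ext ⟨b, hb⟩
      simp only [mem_image, mem_preimage, Subtype.mk.injEq]
      constructor
      · rintro ⟨d, hd, rfl⟩
        exact ⟨_, hd, rfl⟩
      · rintro ⟨a, ha, rfl⟩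
        obtain ⟨d, rfl⟩ : a ∈ range j := hr ▸ hb
        exact ⟨d, ha, rfl⟩
    rw [this]
    exact (hu.isCompact.image hF).isClosed.preimage continuous_subtype_val
  · rintro ⟨b, hb⟩
    obtain ⟨a, rfl⟩ := hs hb
    obtain ⟨d, rfl⟩ : a ∈ range j := hr ▸ hb
    exact ⟨d, rfl⟩

/-- A component that met `U ∩ K` and left `K` would be split by the closed sets `K` and `L`. Later
`K` is a strip of faces and `L` the union of the other faces. -/
theorem connectedComponentIn_eq_of_closed_cover {X : Type*} [TopologicalSpace X] {U K L : Set X}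
    (hK : IsClosed K) (hL : IsClosed L) (hU : U ⊆ K ∪ L) (hd : U ∩ K ∩ L = ∅)
    (hp : IsPreconnected (U ∩ K)) {x : X} (hx : x ∈ U ∩ K) :
    connectedComponentIn U x = U ∩ K := by
  apply Subset.antisymm
  · refine subset_inter (connectedComponentIn_subset U x) ?_
    intro z hz
    by_contra hzK
    have hc : IsPreconnected (connectedComponentIn U x) := isPreconnected_connectedComponentIn
    obtain ⟨w, hw, hwK, hwL⟩ := isPreconnected_closed_iff.1 hc K L hK hL
      ((connectedComponentIn_subset U x).trans hU) ⟨x, mem_connectedComponentIn hx.1, hx.2⟩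
      ⟨z, hz, (hU (connectedComponentIn_subset U x hz)).resolve_left hzK⟩
    have : w ∈ U ∩ K ∩ L := ⟨⟨connectedComponentIn_subset U x hw, hwK⟩, hwL⟩
    simp [hd] at this
  · exact hp.subset_connectedComponentIn hx inter_subset_left

/-- A point of a surface does not separate its neighbourhoods. -/
theorem not_separated_by_point {M : Type*} [TopologicalSpace M]
    [ChartedSpace (EuclideanSpace ℝ (Fin 2)) M] {m : M} {A B O : Set M} (hA : IsClosed A)
    (hB : IsClosed B) (hO : O ∈ 𝓝 m) (hcov : O ⊆ A ∪ B) (hAB : A ∩ B ∩ O ⊆ {m})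
    (hmA : ∀ W ∈ 𝓝 m, ∃ z ∈ W, z ≠ m ∧ z ∈ A) (hmB : ∀ W ∈ 𝓝 m, ∃ z ∈ W, z ≠ m ∧ z ∈ B) :
    False := by
  let e := chartAt (EuclideanSpace ℝ (Fin 2)) m
  have hm : m ∈ e.source := mem_chart_source _ m
  have hem : e m ∈ e.target := e.map_source hm
  have hO' : e.target ∩ e.symm ⁻¹' O ∈ 𝓝 (e m) := by
    apply Filter.inter_mem (e.open_target.mem_nhds hem)
    apply (e.continuousAt_symm hem).preimage_mem_nhds
    rwa [e.left_inv hm]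
  obtain ⟨r, hr, hball⟩ := Metric.mem_nhds_iff.1 hO'
  -- The ball is a homeomorphic image of the whole plane with centre the image of 0, so the
  -- punctured ball inherits connectedness from the punctured plane.
  let b : OpenPartialHomeomorph (EuclideanSpace ℝ (Fin 2)) (EuclideanSpace ℝ (Fin 2)) :=
    OpenPartialHomeomorph.univBall (e m) r
  have hb : b '' {0}ᶜ = Metric.ball (e m) r \ {e m} := by
    have h0 : b 0 = e m := OpenPartialHomeomorph.univBall_apply_zero _ _
    have hs : b.source = univ := OpenPartialHomeomorph.univBall_source _ _
    have ht : b.target = Metric.ball (e m) r := OpenPartialHomeomorph.univBall_target _ hr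
    rw [compl_eq_univ_sdiff, ← ht, ← h0, ← hs, ← b.image_source_eq_target,
      b.injOn.image_sdiff_subset (by simp [hs]), image_singleton]
  have hpb : IsPreconnected (Metric.ball (e m) r \ {e m}) := by
    rw [← hb]
    refine IsPreconnected.image ?_ _ (OpenPartialHomeomorph.continuous_univBall _ _).continuousOn
    refine (isConnected_compl_singleton_of_one_lt_rank ?_ 0).isPreconnected
    rw [← Module.finrank_eq_rank]
    norm_num
  have hp : IsPreconnected (e.symm '' (Metric.ball (e m) r \ {e m})) := by
    refine hpb.image _ (e.continuousOn_symm.mono ?_)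
    exact fun z hz => (hball hz.1).1
  have hW : e.source ∩ e ⁻¹' Metric.ball (e m) r ∈ 𝓝 m :=
    Filter.inter_mem (e.open_source.mem_nhds hm)
      ((e.continuousAt hm).preimage_mem_nhds (Metric.ball_mem_nhds _ hr))
  have hmem : ∀ z ∈ e.source ∩ e ⁻¹' Metric.ball (e m) r, z ≠ m →
      z ∈ e.symm '' (Metric.ball (e m) r \ {e m}) := by
    intro z hz hzm
    refine ⟨e z, ⟨hz.2, fun h => hzm (e.injOn hz.1 hm h)⟩, e.left_inv hz.1⟩
  obtain ⟨a, haW, ham, haA⟩ := hmA _ hW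
  obtain ⟨c, hcW, hcm, hcB⟩ := hmB _ hW
  obtain ⟨w, ⟨z, hz, rfl⟩, hwA, hwB⟩ := isPreconnected_closed_iff.1 hp A B hA hB
    (by
      rintro _ ⟨z, hz, rfl⟩
      exact hcov (hball hz.1).2) ⟨a, hmem a haW ham, haA⟩ ⟨c, hmem c hcW hcm, hcB⟩
  have hzm : e.symm z = m := hAB ⟨⟨hwA, hwB⟩, (hball hz.1).2⟩
  apply hz.2
  rw [mem_singleton_iff, ← hzm, e.right_inv (hball hz.1).1]

/-! ### The model surfaces as quotients of a rectangle, and how to tell them apart. -/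

theorem Circle.exp_two_pi_mul_eq_iff {s t : ℝ} (hs : s ∈ Icc (0 : ℝ) 1) (ht : t ∈ Icc (0 : ℝ) 1) :
    Circle.exp (2 * Real.pi * s) = Circle.exp (2 * Real.pi * t) ↔
      s = t ∨ (s = 0 ∧ t = 1) ∨ (s = 1 ∧ t = 0) := by
  have hpi := Real.pi_pos
  rw [Circle.exp_eq_exp]
  constructor
  · rintro ⟨m, hm⟩
    have h : s = t + m := by
      have : 2 * Real.pi * (s - t - m) = 0 := by linarith
      have := (mul_eq_zero.1 this).resolve_left (by positivity)
      linarith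
    have h1 : m ≤ 1 := by
      have : (m : ℝ) ≤ 1 := by linarith [hs.2, ht.1]
      exact_mod_cast this
    have h2 : -1 ≤ m := by
      have : (-1 : ℝ) ≤ m := by linarith [hs.1, ht.2]
      exact_mod_cast this
    interval_cases m
    · right; left; push_cast at h; constructor <;> linarith [hs.1, ht.2]
    · left; simpa using h
    · right; right; push_cast at h; constructor <;> linarith [hs.2, ht.1]
  · rintro (rfl | ⟨rfl, rfl⟩ | ⟨rfl, rfl⟩)
    · exact ⟨0, by simp⟩
    · exact ⟨-1, by simp⟩
    · exact ⟨1, by simp⟩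

theorem Circle.exists_exp_two_pi_mul (z : Circle) :
    ∃ t ∈ Icc (0 : ℝ) 1, Circle.exp (2 * Real.pi * t) = z := by
  have hpi := Real.pi_pos
  obtain ⟨s, rfl⟩ := Circle.exp_surjective z
  refine ⟨Int.fract (s / (2 * Real.pi)), ⟨Int.fract_nonneg _, (Int.fract_lt_one _).le⟩, ?_⟩
  rw [Circle.exp_eq_exp]
  refine ⟨-⌊s / (2 * Real.pi)⌋, ?_⟩
  rw [Int.fract]
  push_cast
  field_simp
  ring

/-- A closed curve in the disk does not wind around the circle. -/
theorem not_exists_essential_loop {X : Type*} [TopologicalSpace X] (h : X ≃ₜ OpenDisk)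
    {r : X → Circle} (hr : Continuous r) {γ : Icc (0 : ℝ) 1 → X} (hγ : Continuous γ)
    (h01 : γ 0 = γ 1) (hrγ : ∀ t, r (γ t) = Circle.exp (2 * Real.pi * t)) : False := by
  have hcd : ContractibleSpace OpenDisk := Metric.contractibleSpace_ball one_pos
  -- Contractibility and local path connectedness let `r` lift through the covering `Circle.exp`.
  have hlp : LocallyPathConnectedSpace OpenDisk := Metric.isOpen_ball.locallyPathConnectedSpace
  have he : Circle.exp 0 = (⟨fun p => r (h.symm p), hr.comp h.symm.continuous⟩ :
      C(OpenDisk, Circle)) (h (γ 0)) := by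
    simp [hrγ]
  obtain ⟨F, ⟨-, hF⟩, -⟩ := Circle.isCoveringMap_exp.existsUnique_continuousMap_lifts
    (⟨fun p => r (h.symm p), hr.comp h.symm.continuous⟩ : C(OpenDisk, Circle)) (h (γ 0)) 0 he
  let f : Icc (0 : ℝ) 1 → ℝ := fun t => F (h (γ t))
  have hf : Continuous f := F.continuous.comp (h.continuous.comp hγ)
  have hfe : ∀ t, Circle.exp (f t) = Circle.exp (2 * Real.pi * t) := by
    intro t
    have := congrFun hF (h (γ t))
    simpa [f, hrγ] using this
  have hpi := Real.pi_pos
  -- This is integer-valued and continuous, hence constant, whereas `f` takes equal values at 0 and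
  -- 1 and `2πt` does not.
  let g : Icc (0 : ℝ) 1 → ℝ := fun t => (f t - 2 * Real.pi * t) / (2 * Real.pi)
  have hg : Continuous g := by fun_prop
  have hgz : ∀ t, ∃ m : ℤ, g t = m := by
    intro t
    obtain ⟨m, hm⟩ := Circle.exp_eq_exp.1 (hfe t)
    refine ⟨m, ?_⟩
    simp only [g, hm]
    field_simp
    ring
  have hconst : g 0 = g 1 := by
    choose m hm using hgz
    have hmc : Continuous m := by
      rw [Int.isClosedEmbedding_coe_real.isInducing.continuous_iff]
      exact hg.congr hm
    have := PreconnectedSpace.constant (α := Icc (0 : ℝ) 1) inferInstance hmc (x := 0) (y := 1)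
    rw [hm, hm, this]
  simp only [g, f, h01] at hconst
  field_simp at hconst
  simp at hconst
  linarith

/-- A product of a quotient map with an identity need not be a quotient map, but here the circle
factor comes from a compact space, so it is proper and the product is closed. -/
theorem isQuotientMap_cylinder :
    IsQuotientMap (fun p : Icc (0 : ℝ) 1 × Ioo (-1 : ℝ) 1 =>
      ((p.2, Circle.exp (2 * Real.pi * p.1)) : OpenCylinder)) := by
  have hc : Continuous (fun t : Icc (0 : ℝ) 1 => Circle.exp (2 * Real.pi * t)) := by fun_prop
  have hs : Function.Surjective (fun t : Icc (0 : ℝ) 1 => Circle.exp (2 * Real.pi * t)) := by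
    intro z
    obtain ⟨t, ht, rfl⟩ := Circle.exists_exp_two_pi_mul z
    exact ⟨⟨t, ht⟩, rfl⟩
  have hp : IsProperMap (Prod.map (fun t : Icc (0 : ℝ) 1 => Circle.exp (2 * Real.pi * t))
      (id : Ioo (-1 : ℝ) 1 → Ioo (-1 : ℝ) 1)) := hc.isProperMap.prodMap isProperMap_id
  have hq := hp.isClosedMap.isQuotientMap hp.continuous (hs.prodMap Function.surjective_id)
  exact (Homeomorph.prodComm _ _).isQuotientMap.comp hq

theorem nonempty_homeomorph_cylinder {X : Type*} [TopologicalSpace X]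
    {f : Icc (0 : ℝ) 1 × Ioo (-1 : ℝ) 1 → X} (hf : IsQuotientMap f)
    (h : ∀ p q, f p = f q ↔ (p.2 : ℝ) = q.2 ∧
      ((p.1 : ℝ) = q.1 ∨ ((p.1 : ℝ) = 0 ∧ (q.1 : ℝ) = 1) ∨ ((p.1 : ℝ) = 1 ∧ (q.1 : ℝ) = 0))) :
    Nonempty (X ≃ₜ OpenCylinder) := by
  refine nonempty_homeomorph_of_isQuotientMap hf isQuotientMap_cylinder fun p q => ?_
  rw [h, Prod.mk.injEq, Circle.exp_two_pi_mul_eq_iff p.1.2 q.1.2, Subtype.ext_iff]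

theorem nonempty_homeomorph_mobius {X : Type*} [TopologicalSpace X]
    {f : Icc (0 : ℝ) 1 × Ioo (-1 : ℝ) 1 → X} (hf : IsQuotientMap f)
    (h : ∀ p q, f p = f q ↔ ((p.1 : ℝ) = q.1 ∧ (p.2 : ℝ) = q.2) ∨ ((q.2 : ℝ) = -p.2 ∧
      (((p.1 : ℝ) = 0 ∧ (q.1 : ℝ) = 1) ∨ ((p.1 : ℝ) = 1 ∧ (q.1 : ℝ) = 0)))) :
    Nonempty (X ≃ₜ OpenMobiusStrip) := by
  refine nonempty_homeomorph_of_isQuotientMap hf isQuotientMap_quot_mk fun p q => ?_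
  constructor
  · intro hpq
    rcases (h p q).1 hpq with ⟨h1, h2⟩ | ⟨h2, ⟨h0, h1⟩ | ⟨h1, h0⟩⟩
    · rw [show p = q from Prod.ext (Subtype.ext h1) (Subtype.ext h2)]
    · exact Quot.sound ⟨h0, h1, h2⟩
    · exact (Quot.sound ⟨h0, h1, by linarith⟩).symm
  · intro hpq
    -- The gluing relation is not an equivalence relation. Equality in the quotient is detected by
    -- letting `f` itself descend to it.
    have hl : ∀ p q : Icc (0 : ℝ) 1 × Ioo (-1 : ℝ) 1,
        ((p.1 : ℝ) = 0 ∧ (q.1 : ℝ) = 1 ∧ (q.2 : ℝ) = -(p.2 : ℝ)) → f p = f q :=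
      fun p q ⟨h0, h1, h2⟩ => (h p q).2 (Or.inr ⟨h2, Or.inl ⟨h0, h1⟩⟩)
    exact congrArg (Quot.lift f hl) hpq

/-- Polar coordinates on the disk; the radius is `(1 - y) / 2`. -/
noncomputable def polarMap (t y : ℝ) : EuclideanSpace ℝ (Fin 2) :=
  Complex.orthonormalBasisOneI.repr (((1 - y) / 2 : ℝ) * (Circle.exp (2 * Real.pi * t) : ℂ))

theorem norm_polarMap (t y : ℝ) : ‖polarMap t y‖ = |(1 - y) / 2| := by
  rw [polarMap, LinearIsometryEquiv.norm_map, norm_mul, Complex.norm_real, Circle.norm_coe,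
    mul_one, Real.norm_eq_abs]

theorem polarMap_eq_iff {s t y z : ℝ} (hs : s ∈ Icc (0 : ℝ) 1) (ht : t ∈ Icc (0 : ℝ) 1)
    (hy : y ≤ 1) (hz : z ≤ 1) : polarMap s y = polarMap t z ↔ y = z ∧
      (y = 1 ∨ s = t ∨ (s = 0 ∧ t = 1) ∨ (s = 1 ∧ t = 0)) := by
  constructor
  · intro h
    have hyz : y = z := by
      have := congrArg norm h
      rw [norm_polarMap, norm_polarMap, abs_of_nonneg (by linarith),
        abs_of_nonneg (by linarith)] at this
      linarith
    subst hyz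
    refine ⟨rfl, ?_⟩
    rw [or_iff_not_imp_left]
    intro hy1
    rw [← Circle.exp_two_pi_mul_eq_iff hs ht]
    have h' := (LinearIsometryEquiv.injective _) h
    have hne : (((1 - y) / 2 : ℝ) : ℂ) ≠ 0 := by
      rw [Complex.ofReal_ne_zero]
      intro h0
      exact hy1 (by linarith)
    exact Circle.ext (mul_left_cancel₀ hne h')
  · rintro ⟨rfl, h⟩
    rcases eq_or_ne y 1 with rfl | hy1
    · simp [polarMap]
    · rw [polarMap, polarMap, (Circle.exp_two_pi_mul_eq_iff hs ht).2 (h.resolve_left hy1)]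

theorem exists_polarMap_eq {x : EuclideanSpace ℝ (Fin 2)} (hx : ‖x‖ ≤ 1) :
    ∃ t ∈ Icc (0 : ℝ) 1, ∃ y ∈ Icc (-1 : ℝ) 1, polarMap t y = x := by
  obtain ⟨c, rfl⟩ := Complex.orthonormalBasisOneI.repr.surjective x
  rw [LinearIsometryEquiv.norm_map] at hx
  obtain ⟨t, ht, h⟩ := Circle.exists_exp_two_pi_mul (Circle.exp c.arg)
  refine ⟨t, ht, 1 - 2 * ‖c‖, ⟨by linarith, by linarith [norm_nonneg c]⟩, ?_⟩
  rw [polarMap, h]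
  congr 1
  rw [Circle.coe_exp]
  have : (1 - (1 - 2 * ‖c‖)) / 2 = ‖c‖ := by ring
  rw [this, Complex.norm_mul_exp_arg_mul_I]

/-- The line y = 1 becomes the centre. The half-open rectangle is not compact, so the polar map is
shown to be a quotient map by restricting it from the closed rectangle. -/
theorem nonempty_homeomorph_disk {X : Type*} [TopologicalSpace X]
    {f : Icc (0 : ℝ) 1 × Ioc (-1 : ℝ) 1 → X} (hf : IsQuotientMap f)
    (h : ∀ p q, f p = f q ↔ (p.2 : ℝ) = q.2 ∧ ((p.2 : ℝ) = 1 ∨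
      ((p.1 : ℝ) = q.1 ∨ ((p.1 : ℝ) = 0 ∧ (q.1 : ℝ) = 1) ∨ ((p.1 : ℝ) = 1 ∧ (q.1 : ℝ) = 0)))) :
    Nonempty (X ≃ₜ OpenDisk) := by
  have hm : ∀ d : Icc (0 : ℝ) 1 × Ioc (-1 : ℝ) 1,
      polarMap d.1 d.2 ∈ Metric.ball (0 : EuclideanSpace ℝ (Fin 2)) 1 := by
    rintro ⟨t, y, hy⟩
    rw [mem_ball_zero_iff, norm_polarMap, abs_lt]
    constructor <;> linarith [hy.1, hy.2]
  have hF : Continuous fun p : Icc (0 : ℝ) 1 × Icc (-1 : ℝ) 1 => polarMap p.1 p.2 := by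
    unfold polarMap
    fun_prop
  refine nonempty_homeomorph_of_isQuotientMap hf (isQuotientMap_codRestrict
    (A := Icc (0 : ℝ) 1 × Icc (-1 : ℝ) 1) (F := fun p => polarMap p.1 p.2)
    (j := Prod.map id (inclusion Ioc_subset_Icc_self)) ?_ ?_ ?_ ?_ hm) fun p q => ?_
  · exact hF
  · exact IsEmbedding.id.prodMap (IsEmbedding.inclusion _)
  · ext ⟨t, y, hy⟩
    simp only [range_prodMap, mem_prod, mem_preimage, mem_ball_zero_iff, norm_polarMap, range_id,
      mem_univ, true_and, range_inclusion]
    rw [abs_of_nonneg (by linarith [hy.2])]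
    constructor
    · intro h1
      linarith [h1.1]
    · intro h1
      exact ⟨by linarith, hy.2⟩
  · intro x hx
    obtain ⟨t, ht, y, hy, rfl⟩ := exists_polarMap_eq (mem_ball_zero_iff.1 hx).le
    exact ⟨(⟨t, ht⟩, ⟨y, hy⟩), rfl⟩
  · rw [h, Subtype.ext_iff]
    exact (polarMap_eq_iff p.1.2 q.1.2 p.2.2.2 q.2.2.2).symm

theorem not_nonempty_cylinder_homeomorph_disk : ¬ Nonempty (OpenCylinder ≃ₜ OpenDisk) := by
  rintro ⟨h⟩
  exact not_exists_essential_loop h (r := fun p => p.2) continuous_snd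
    (γ := fun t => (⟨0, by norm_num⟩, Circle.exp (2 * Real.pi * t))) (by fun_prop)
    (by simp) fun t => rfl

/-- The flip changes only the second coordinate, so the first one still descends to the circle; the
core line y = 0 closes up because 0 = -0. -/
theorem not_nonempty_mobius_homeomorph_disk : ¬ Nonempty (OpenMobiusStrip ≃ₜ OpenDisk) := by
  rintro ⟨h⟩
  refine not_exists_essential_loop h
    (r := Quot.lift (fun p => Circle.exp (2 * Real.pi * p.1)) ?_) ?_
    (γ := fun t => Quot.mk _ (t, ⟨0, by norm_num⟩)) ?_ ?_ fun t => rfl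
  · rintro p q ⟨h0, h1, -⟩
    simp [h0, h1]
  · exact continuous_quot_lift _ (by fun_prop)
  · exact continuous_quot_mk.comp (continuous_id.prodMk continuous_const)
  · exact Quot.sound ⟨rfl, rfl, by simp⟩

/-! ### Combinatorics of walks across edges of type I. -/

namespace SurfaceTriangulation

variable {V : Type*} [Fintype V] [DecidableEq V] {M : Type*} [TopologicalSpace M]
  {T : SurfaceTriangulation V M} {τ : Set (ℤ → Finset V)}

theorem eq_or_eq_of_edge_subset {e s t u : Finset V} (he : e.card = 2) (hs : s ∈ T.faces)
    (ht : t ∈ T.faces) (hu : u ∈ T.faces) (hst : s ≠ t) (hes : e ⊆ s) (het : e ⊆ t)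
    (heu : e ⊆ u) : u = s ∨ u = t := by
  have h := T.card_faces_edge e he ⟨s, hs, hes⟩
  have hsub : ({s, t} : Finset (Finset V)) ⊆ T.faces.filter fun s => e ⊆ s := by
    intro x hx
    rcases Finset.mem_insert.1 hx with rfl | hx
    · exact Finset.mem_filter.2 ⟨hs, hes⟩
    · rw [Finset.mem_singleton.1 hx]
      exact Finset.mem_filter.2 ⟨ht, het⟩
  have heq := Finset.eq_of_subset_of_card_le hsub (by rw [h, Finset.card_pair hst])
  have : u ∈ ({s, t} : Finset (Finset V)) := heq ▸ Finset.mem_filter.2 ⟨hu, heu⟩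
  simpa using this

theorem exists_other_face {e s : Finset V} (he : e.card = 2) (hs : s ∈ T.faces) (hes : e ⊆ s) :
    ∃ t ∈ T.faces, t ≠ s ∧ e ⊆ t := by
  have h := T.card_faces_edge e he ⟨s, hs, hes⟩
  obtain ⟨t, ht, hts⟩ := Finset.exists_mem_ne (h ▸ one_lt_two) s
  exact ⟨t, (Finset.mem_filter.1 ht).1, hts, (Finset.mem_filter.1 ht).2⟩

theorem IsEdgeI.ne {u v : V} (h : T.IsEdgeI τ {u, v}) : u ≠ v := by
  rintro rfl
  have := h.1.1
  simp at this

variable (T τ) in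
/-- A walk through faces across their edges of type I: `{P i, Q i}` is the edge through which
the walk enters the face `S i`. -/
structure IsStrip (P Q : ℕ → V) (S : ℕ → Finset V) : Prop where
  face : ∀ i, S i ∈ T.faces
  edge : ∀ i, T.IsEdgeI τ {P i, Q i}
  edge_subset : ∀ i, {P i, Q i} ⊆ S i
  succ_edge_subset : ∀ i, {P (i + 1), Q (i + 1)} ⊆ S i
  ne_succ : ∀ i, S i ≠ S (i + 1)
  step : ∀ i, (P (i + 1) = P i ∧ Q (i + 1) ≠ Q i ∧ T.IsEdgeII τ {Q i, Q (i + 1)}) ∨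
    (Q (i + 1) = Q i ∧ P (i + 1) ≠ P i ∧ T.IsEdgeII τ {P i, P (i + 1)})

/-- An edge of type I in the face contains the apex. The walk leaves through the other side of type
I, keeping the apex fixed and moving the other end along the side of type II. -/
theorem exists_strip_step {p q : V} {s : Finset V} (hI : ∀ s ∈ T.faces, T.IsFaceI τ s)
    (hs : s ∈ T.faces) (he : T.IsEdgeI τ {p, q}) (hes : {p, q} ⊆ s) :
    ∃ p' q' s', s' ∈ T.faces ∧ T.IsEdgeI τ {p', q'} ∧ {p', q'} ⊆ s ∧ {p', q'} ⊆ s' ∧ s ≠ s' ∧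
      ((p' = p ∧ q' ≠ q ∧ T.IsEdgeII τ {q, q'}) ∨ (q' = q ∧ p' ≠ p ∧ T.IsEdgeII τ {p, p'})) := by
  have key : ∃ p' q', T.IsEdgeI τ {p', q'} ∧ {p', q'} ⊆ s ∧
      ((p' = p ∧ q' ≠ q ∧ T.IsEdgeII τ {q, q'}) ∨ (q' = q ∧ p' ≠ p ∧ T.IsEdgeII τ {p, p'})) := by
    obtain ⟨-, a, b, c, rfl, hab, hac, hbc⟩ := hI s hs
    have hcb : T.IsEdgeII τ {c, b} := Finset.pair_comm b c ▸ hbc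
    have hba : T.IsEdgeI τ {b, a} := Finset.pair_comm a b ▸ hab
    have hca : T.IsEdgeI τ {c, a} := Finset.pair_comm a c ▸ hac
    have hne : b ≠ c := by
      rintro rfl
      have := hbc.1.1
      simp at this
    have hp : p = a ∨ p = b ∨ p = c := by simpa using hes (Finset.mem_insert_self p {q})
    have hq : q = a ∨ q = b ∨ q = c := by
      simpa using hes (Finset.mem_insert_of_mem (Finset.mem_singleton_self q))
    have hpq := he.ne
    rcases hp with rfl | rfl | rfl <;> rcases hq with rfl | rfl | rfl
    · exact absurd rfl hpq
    · exact ⟨p, c, hac, by simp [Finset.insert_subset_iff], Or.inl ⟨rfl, hne.symm, hbc⟩⟩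
    · exact ⟨p, b, hab, by simp [Finset.insert_subset_iff], Or.inl ⟨rfl, hne, hcb⟩⟩
    · exact ⟨c, q, hca, by simp [Finset.insert_subset_iff], Or.inr ⟨rfl, hne.symm, hbc⟩⟩
    · exact absurd rfl hpq
    · exact absurd he hbc.2
    · exact ⟨b, q, hba, by simp [Finset.insert_subset_iff], Or.inr ⟨rfl, hne, hcb⟩⟩
    · exact absurd he hcb.2
    · exact absurd rfl hpq
  obtain ⟨p', q', he', hes', h⟩ := key
  obtain ⟨t, ht, hts, het⟩ := exists_other_face he'.1.1 hs hes'
  exact ⟨p', q', t, ht, he', hes', het, hts.symm, h⟩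

theorem exists_strip {s : Finset V} (hI : ∀ s ∈ T.faces, T.IsFaceI τ s) (hs : s ∈ T.faces) :
    ∃ P Q S, T.IsStrip τ P Q S ∧ S 0 = s := by
  obtain ⟨-, a, b, c, hsabc, hab, -⟩ := hI s hs
  let St := {x : V × V × Finset V // x.2.2 ∈ T.faces ∧ T.IsEdgeI τ {x.1, x.2.1} ∧
    {x.1, x.2.1} ⊆ x.2.2}
  have hstep : ∀ x : St, ∃ y : St, {y.1.1, y.1.2.1} ⊆ x.1.2.2 ∧ x.1.2.2 ≠ y.1.2.2 ∧
      ((y.1.1 = x.1.1 ∧ y.1.2.1 ≠ x.1.2.1 ∧ T.IsEdgeII τ {x.1.2.1, y.1.2.1}) ∨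
        (y.1.2.1 = x.1.2.1 ∧ y.1.1 ≠ x.1.1 ∧ T.IsEdgeII τ {x.1.1, y.1.1})) := by
    rintro ⟨⟨p, q, t⟩, ht, he, het⟩
    obtain ⟨p', q', t', ht', he', h1, h2, h3, h4⟩ := exists_strip_step hI ht he het
    exact ⟨⟨(p', q', t'), ht', he', h2⟩, h1, h3, h4⟩
  choose f hf using hstep
  let x : ℕ → St := fun i => f^[i] ⟨(a, b, s), hs, hab, by simp [hsabc, Finset.insert_subset_iff]⟩
  have hx : ∀ i, x (i + 1) = f (x i) := fun i => Function.iterate_succ_apply' f i _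
  refine ⟨fun i => (x i).1.1, fun i => (x i).1.2.1, fun i => (x i).1.2.2,
    ⟨fun i => (x i).2.1, fun i => (x i).2.2.1, fun i => (x i).2.2.2, ?_, ?_, ?_⟩, rfl⟩
  all_goals intro i; simp only [hx]
  · exact (hf _).1
  · exact (hf _).2.1
  · exact (hf _).2.2

namespace IsStrip

variable {P Q : ℕ → V} {S : ℕ → Finset V}

theorem swap (h : T.IsStrip τ P Q S) : T.IsStrip τ Q P S where
  face := h.face
  edge i := Finset.pair_comm (P i) (Q i) ▸ h.edge i
  edge_subset i := Finset.pair_comm (P i) (Q i) ▸ h.edge_subset i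
  succ_edge_subset i := Finset.pair_comm (P (i + 1)) (Q (i + 1)) ▸ h.succ_edge_subset i
  ne_succ := h.ne_succ
  step i := (h.step i).symm

theorem ne (h : T.IsStrip τ P Q S) (i : ℕ) : P i ≠ Q i := (h.edge i).ne

theorem left_mem (h : T.IsStrip τ P Q S) (i : ℕ) : P i ∈ S i := h.edge_subset i (by simp)

theorem right_mem (h : T.IsStrip τ P Q S) (i : ℕ) : Q i ∈ S i := h.edge_subset i (by simp)

theorem succ_left_mem (h : T.IsStrip τ P Q S) (i : ℕ) : P (i + 1) ∈ S i :=
  h.succ_edge_subset i (by simp)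

theorem succ_right_mem (h : T.IsStrip τ P Q S) (i : ℕ) : Q (i + 1) ∈ S i :=
  h.succ_edge_subset i (by simp)

theorem face_eq_of_left (h : T.IsStrip τ P Q S) {i : ℕ} (hP : P (i + 1) = P i)
    (hQ : Q (i + 1) ≠ Q i) : S i = {P i, Q i, Q (i + 1)} := by
  symm
  apply Finset.eq_of_subset_of_card_le
  · simp [Finset.insert_subset_iff, h.left_mem i, h.right_mem i, h.succ_right_mem i]
  · rw [T.card_face _ (h.face i), Finset.card_eq_three.2 ⟨P i, Q i, Q (i + 1), h.ne i, ?_,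
      hQ.symm, rfl⟩]
    exact hP ▸ h.ne (i + 1)

theorem face_eq (h : T.IsStrip τ P Q S) (i : ℕ) :
    S i = {P i, Q i} ∪ {P (i + 1), Q (i + 1)} := by
  rcases h.step i with ⟨h1, h2, -⟩ | ⟨h1, h2, -⟩
  · rw [h.face_eq_of_left h1 h2, h1]
    ext x
    simp only [Finset.mem_union, Finset.mem_insert, Finset.mem_singleton]
    tauto
  · rw [h.swap.face_eq_of_left h1 h2, h1]
    ext x
    simp only [Finset.mem_union, Finset.mem_insert, Finset.mem_singleton]
    tauto

theorem edge_ne_succ_edge (h : T.IsStrip τ P Q S) (i : ℕ) :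
    ({P i, Q i} : Finset V) ≠ {P (i + 1), Q (i + 1)} := by
  intro he
  have h1 := h.face_eq i
  rw [← he, Finset.union_self] at h1
  have h2 := T.card_face _ (h.face i)
  rw [h1, (h.edge i).1.1] at h2
  omega

/-- Otherwise this face would contain both crossed sides of `S (i + 1)` and so coincide with it.
This prevents the walk from turning back. -/
theorem face_ne_add_two (h : T.IsStrip τ P Q S) (i : ℕ) : S (i + 2) ≠ S i := by
  intro he
  apply h.ne_succ i
  symm
  apply Finset.eq_of_subset_of_card_le
  · rw [h.face_eq (i + 1)]
    exact Finset.union_subset (h.succ_edge_subset i) (he ▸ h.edge_subset (i + 2))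
  · rw [T.card_face _ (h.face i), T.card_face _ (h.face (i + 1))]

theorem edgeI_subset_of_left (h : T.IsStrip τ P Q S) {i : ℕ} (hP : P (i + 1) = P i)
    (hQ : Q (i + 1) ≠ Q i) (hII : T.IsEdgeII τ {Q i, Q (i + 1)}) {u v : V}
    (he : T.IsEdgeI τ {u, v}) (hes : {u, v} ⊆ S i) :
    ({u, v} : Finset V) = {P i, Q i} ∨ ({u, v} : Finset V) = {P (i + 1), Q (i + 1)} := by
  rw [h.face_eq_of_left hP hQ] at hes
  have hu : u = P i ∨ u = Q i ∨ u = Q (i + 1) := by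
    simpa using hes (Finset.mem_insert_self u {v})
  have hv : v = P i ∨ v = Q i ∨ v = Q (i + 1) := by
    simpa using hes (Finset.mem_insert_of_mem (Finset.mem_singleton_self v))
  have huv := he.ne
  have hII' : T.IsEdgeII τ {Q (i + 1), Q i} := Finset.pair_comm (Q i) _ ▸ hII
  rw [hP]
  rcases hu with rfl | rfl | rfl <;> rcases hv with rfl | rfl | rfl
  · exact absurd rfl huv
  · exact Or.inl rfl
  · exact Or.inr rfl
  · exact Or.inl (Finset.pair_comm _ _)
  · exact absurd rfl huv
  · exact absurd he hII.2
  · exact Or.inr (Finset.pair_comm _ _)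
  · exact absurd he hII'.2
  · exact absurd rfl huv

theorem edgeI_subset (h : T.IsStrip τ P Q S) (i : ℕ) {u v : V}
    (he : T.IsEdgeI τ {u, v}) (hes : {u, v} ⊆ S i) :
    ({u, v} : Finset V) = {P i, Q i} ∨ ({u, v} : Finset V) = {P (i + 1), Q (i + 1)} := by
  rcases h.step i with ⟨h1, h2, h3⟩ | ⟨h1, h2, h3⟩
  · exact h.edgeI_subset_of_left h1 h2 h3 he hes
  · rw [Finset.pair_comm (P i), Finset.pair_comm (P (i + 1))]
    exact h.swap.edgeI_subset_of_left h1 h2 h3 he hes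

theorem eq_of_succ_edge_subset (h : T.IsStrip τ P Q S) (i : ℕ) {t : Finset V}
    (ht : t ∈ T.faces) (het : {P (i + 1), Q (i + 1)} ⊆ t) : t = S i ∨ t = S (i + 1) :=
  eq_or_eq_of_edge_subset (h.edge (i + 1)).1.1 (h.face i) (h.face (i + 1)) ht (h.ne_succ i)
    (h.succ_edge_subset i) (h.edge_subset (i + 1)) het

/-- The first face that the walk meets again is the first one, and the walk then enters it as it
did at the beginning. -/
theorem exists_period (h : T.IsStrip τ P Q S) : ∃ n, 0 < n ∧ InjOn S (Iio n) ∧ S n = S 0 ∧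
    ((P n = P 0 ∧ Q n = Q 0) ∨ (P n = Q 0 ∧ Q n = P 0)) := by
  have hex : ∃ n, ∃ j < n, S n = S j := by
    obtain ⟨i, j, hij, hS⟩ := Finite.exists_ne_map_eq_of_infinite S
    rcases lt_or_gt_of_ne hij with hlt | hlt
    · exact ⟨j, i, hlt, hS.symm⟩
    · exact ⟨i, j, hlt, hS⟩
  classical
  obtain ⟨n, hn, hmin⟩ : ∃ n, (∃ j < n, S n = S j) ∧ ∀ m < n, ¬ ∃ j < m, S m = S j :=
    ⟨Nat.find hex, Nat.find_spec hex, fun m hm => Nat.find_min hex hm⟩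
  have hinj : ∀ i j, i < n → j < n → S i = S j → i = j := by
    intro i j hi hj hS
    rcases lt_trichotomy i j with hlt | heq | hlt
    · exact absurd ⟨i, hlt, hS.symm⟩ (hmin j hj)
    · exact heq
    · exact absurd ⟨j, hlt, hS⟩ (hmin i hi)
  obtain ⟨j, hj, hS⟩ := hn
  obtain ⟨m, rfl⟩ : ∃ m, n = m + 1 := ⟨n - 1, by omega⟩
  have hjm : S m ≠ S j := by
    rw [← hS]
    exact h.ne_succ m
  -- The repeated face `S j` is entered through one of its two sides of type I, and `S m` also
  -- contains that side. For the entrance side with `j > 0` this makes `S m` equal to `S (j - 1)` or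
  -- `S j`, both excluded. For the exit side it leaves only `m = j + 1`, a walk that turns back.
  have hmain : j = 0 ∧ ({P (m + 1), Q (m + 1)} : Finset V) = {P j, Q j} := by
    rcases h.edgeI_subset j (h.edge (m + 1)) (hS ▸ h.edge_subset (m + 1)) with he | he
    · refine ⟨?_, he⟩
      by_contra hj0
      obtain ⟨k, rfl⟩ : ∃ k, j = k + 1 := ⟨j - 1, by omega⟩
      have h1 := h.succ_edge_subset m
      rw [he] at h1
      rcases h.eq_of_succ_edge_subset k (h.face m) h1 with h2 | h2
      · have := hinj m k (by omega) (by omega) h2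
        omega
      · exact absurd h2 hjm
    · exfalso
      have h1 := h.succ_edge_subset m
      rw [he] at h1
      rcases h.eq_of_succ_edge_subset j (h.face m) h1 with h2 | h2
      · exact hjm h2
      · have hne : j ≠ m := fun h => hjm (h ▸ rfl)
        have := hinj m (j + 1) (by omega) (by omega) h2
        subst this
        exact h.face_ne_add_two j hS
  obtain ⟨rfl, he⟩ := hmain
  refine ⟨m + 1, hj, fun i hi j hj => hinj i j hi hj, hS, ?_⟩
  have h1 : P (m + 1) = P 0 ∨ P (m + 1) = Q 0 := by
    have : P (m + 1) ∈ ({P 0, Q 0} : Finset V) := he ▸ by simp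
    simpa using this
  have h2 : Q (m + 1) = P 0 ∨ Q (m + 1) = Q 0 := by
    have : Q (m + 1) ∈ ({P 0, Q 0} : Finset V) := he ▸ by simp
    simpa using this
  have h3 := h.ne (m + 1)
  rcases h1 with h1 | h1 <;> rcases h2 with h2 | h2
  · exact absurd (h1.trans h2.symm) h3
  · exact Or.inl ⟨h1, h2⟩
  · exact Or.inr ⟨h1, h2⟩
  · exact absurd (h1.trans h2.symm) h3

/-- `S i` must be one of the two faces `S (j - 1)`, `S j` at the common edge; injectivity leaves
only the wrap-around. -/
theorem eq_of_edge_eq (h : T.IsStrip τ P Q S) {n : ℕ} (hinj : InjOn S (Iio n)) (hn : S n = S 0)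
    {i j : ℕ} (hij : i < j) (hj : j ≤ n) (he : ({P i, Q i} : Finset V) = {P j, Q j}) :
    i = 0 ∧ j = n := by
  obtain ⟨k, rfl⟩ : ∃ k, j = k + 1 := ⟨j - 1, by omega⟩
  rcases h.eq_of_succ_edge_subset k (h.face i) (he ▸ h.edge_subset i) with h1 | h1
  · have := hinj (mem_Iio.2 (by omega)) (mem_Iio.2 (by omega)) h1
    subst this
    exact absurd he (h.edge_ne_succ_edge i)
  · rcases hj.lt_or_eq with h2 | h2
    · have := hinj (mem_Iio.2 (by omega)) (mem_Iio.2 h2) h1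
      omega
    · rw [h2, hn] at h1
      exact ⟨hinj (mem_Iio.2 (by omega)) (mem_Iio.2 (by omega)) h1, h2⟩

theorem exists_eq_of_edge_subset (h : T.IsStrip τ P Q S) {n : ℕ} (hn0 : 0 < n)
    (hn : (P n = P 0 ∧ Q n = Q 0) ∨ (P n = Q 0 ∧ Q n = P 0)) (hSn : S n = S 0) {i : ℕ}
    (hi : i ≤ n) {t : Finset V} (ht : t ∈ T.faces) (het : {P i, Q i} ⊆ t) : ∃ k < n, t = S k := by
  have hpos : ∀ i, i < n → {P (i + 1), Q (i + 1)} ⊆ t → ∃ k < n, t = S k := by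
    intro i hi het
    rcases h.eq_of_succ_edge_subset i ht het with h1 | h1
    · exact ⟨i, hi, h1⟩
    · rcases (Nat.succ_le_of_lt hi).lt_or_eq with h2 | h2
      · exact ⟨i + 1, h2, h1⟩
      · exact ⟨0, hn0, by rw [h1, ← hSn]; exact congrArg S h2⟩
  rcases Nat.eq_zero_or_pos i with rfl | h0
  -- The initial edge has no predecessor face in the indexing, so it is treated as the final edge,
  -- where `S (n - 1)` is available.
  · have he : ({P n, Q n} : Finset V) = {P 0, Q 0} := by
      rcases hn with ⟨h1, h2⟩ | ⟨h1, h2⟩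
      · rw [h1, h2]
      · rw [h1, h2, Finset.pair_comm]
    obtain ⟨m, rfl⟩ : ∃ m, n = m + 1 := ⟨n - 1, by omega⟩
    exact hpos m (by omega) (he ▸ het)
  · obtain ⟨m, rfl⟩ : ∃ m, i = m + 1 := ⟨i - 1, by omega⟩
    exact hpos m (by omega) het

/-- Both ends of the side of type II are of type II, so the vertex is the apex, which the entrance
and exit edges share. -/
theorem vertexI_mem (h : T.IsStrip τ P Q S) {i : ℕ} {v : V} (hv : T.IsVertexI τ v)
    (hvS : v ∈ S i) : (P i = v ∧ P (i + 1) = v) ∨ (Q i = v ∧ Q (i + 1) = v) := by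
  rcases h.step i with ⟨h1, h2, h3⟩ | ⟨h1, h2, h3⟩
  · rw [h.face_eq_of_left h1 h2] at hvS
    have hn : v ∉ ({Q i, Q (i + 1)} : Finset V) := fun hm => h3.2 (hv _ h3.1 hm)
    simp only [Finset.mem_insert, Finset.mem_singleton, not_or] at hvS hn
    have : v = P i := by tauto
    exact Or.inl ⟨this.symm, h1.trans this.symm⟩
  · rw [h.swap.face_eq_of_left h1 h2] at hvS
    have hn : v ∉ ({P i, P (i + 1)} : Finset V) := fun hm => h3.2 (hv _ h3.1 hm)
    simp only [Finset.mem_insert, Finset.mem_singleton, not_or] at hvS hn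
    have : v = Q i := by tauto
    exact Or.inr ⟨this.symm, h1.trans this.symm⟩

theorem vertexI_mem_zero (h : T.IsStrip τ P Q S) {v : V} (hv : T.IsVertexI τ v) (i : ℕ)
    (hvS : v ∈ S i) : v ∈ S 0 := by
  induction i with
  | zero => exact hvS
  | succ i ih =>
    apply ih
    rcases h.vertexI_mem hv hvS with ⟨h1, -⟩ | ⟨h1, -⟩
    · exact h1 ▸ h.succ_left_mem i
    · exact h1 ▸ h.succ_right_mem i

theorem left_eq_of_vertexI (h : T.IsStrip τ P Q S) {v : V} (hv : T.IsVertexI τ v)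
    (h0 : P 0 = v) (i : ℕ) : P i = v := by
  induction i with
  | zero => exact h0
  | succ i ih =>
    rcases h.vertexI_mem hv (ih ▸ h.left_mem i) with ⟨-, h1⟩ | ⟨h1, -⟩
    · exact h1
    · exact absurd (ih.trans h1.symm) (h.ne i)

end IsStrip

end SurfaceTriangulation

/-! ### Piecewise linear parametrization of a strip by a rectangle. -/

/-- The point of the segment from the vertex `q` (for `y = -1`) to the vertex `p` (for `y = 1`). -/
noncomputable def crossPoint {V : Type*} [DecidableEq V] (p q : V) (y : ℝ) (v : V) : ℝ :=
  (1 + y) / 2 * (if v = p then 1 else 0) + (1 - y) / 2 * (if v = q then 1 else 0)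

section crossPoint

variable {V : Type*} [DecidableEq V] {p q : V} {y z : ℝ}

theorem crossPoint_swap (p q : V) (y : ℝ) : crossPoint q p (-y) = crossPoint p q y := by
  ext v
  simp only [crossPoint]
  ring

theorem crossPoint_nonneg (hy : y ∈ Icc (-1 : ℝ) 1) (v : V) : 0 ≤ crossPoint p q y v := by
  have h1 : 0 ≤ (1 + y) / 2 := by linarith [hy.1]
  have h2 : 0 ≤ (1 - y) / 2 := by linarith [hy.2]
  unfold crossPoint
  positivity

theorem crossPoint_pos (hy : y ∈ Ioo (-1 : ℝ) 1) {v : V} (hv : v ∈ ({p, q} : Finset V)) :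
    0 < crossPoint p q y v := by
  have h1 : 0 < (1 + y) / 2 := by linarith [hy.1]
  have h2 : 0 < (1 - y) / 2 := by linarith [hy.2]
  unfold crossPoint
  rcases eq_or_ne v p with rfl | hp
  · simp only [if_true, mul_one]
    positivity
  · have : v = q := by simpa [hp] using hv
    simp only [this, if_true, mul_one]
    positivity

theorem crossPoint_eq_zero {v : V} (hv : v ∉ ({p, q} : Finset V)) : crossPoint p q y v = 0 := by
  simp only [Finset.mem_insert, Finset.mem_singleton, not_or] at hv
  simp [crossPoint, hv.1, hv.2]

theorem crossPoint_ne_zero_iff (hy : y ∈ Ioo (-1 : ℝ) 1) {v : V} :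
    crossPoint p q y v ≠ 0 ↔ v ∈ ({p, q} : Finset V) :=
  ⟨fun h => by_contra fun hv => h (crossPoint_eq_zero hv), fun h => (crossPoint_pos hy h).ne'⟩

theorem sum_crossPoint [Fintype V] (p q : V) (y : ℝ) : ∑ v, crossPoint p q y v = 1 := by
  simp only [crossPoint, Finset.sum_add_distrib, ← Finset.mul_sum, Finset.sum_ite_eq',
    Finset.mem_univ, if_true, mul_one]
  ring

theorem crossPoint_left (h : p ≠ q) : crossPoint p q y p = (1 + y) / 2 := by
  simp [crossPoint, h]

theorem crossPoint_eq_iff (h : p ≠ q) : crossPoint p q y = crossPoint p q z ↔ y = z := by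
  refine ⟨fun he => ?_, fun he => by rw [he]⟩
  have := congrFun he p
  rw [crossPoint_left h, crossPoint_left h] at this
  linarith

end crossPoint

/-- The band spanned by the segments `crossPoint (P i) (Q i)`, `i = 0, …, n`, that are placed over
the points `i / n` of `[0, 1]`, with linear interpolation between them. -/
noncomputable def bandPoint {V : Type*} [DecidableEq V] (P Q : ℕ → V) (n : ℕ) (t y : ℝ) (v : V) :
    ℝ :=
  ∑ i ∈ Finset.range (n + 1), max 0 (1 - |t * n - i|) * crossPoint (P i) (Q i) y v

section bandPoint

variable {V : Type*} [DecidableEq V] {P Q : ℕ → V} {n i : ℕ} {t y r : ℝ}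

theorem bandPoint_swap (P Q : ℕ → V) (n : ℕ) (t y : ℝ) :
    bandPoint Q P n t (-y) = bandPoint P Q n t y := by
  ext v
  simp only [bandPoint, crossPoint_swap]

theorem bandPoint_eq_interpolation (hi : i < n) (hr : r ∈ Icc (0 : ℝ) 1) (ht : t * n = i + r)
    (v : V) : bandPoint P Q n t y v =
      (1 - r) * crossPoint (P i) (Q i) y v + r * crossPoint (P (i + 1)) (Q (i + 1)) y v := by
  unfold bandPoint
  -- The weights are hat functions of width one around the integers, so only those at `i` and `i +
  -- 1` can be nonzero.
  rw [Finset.sum_eq_add i (i + 1) (by omega)]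
  · have h1 : t * n - i = r := by linarith
    have h2 : t * n - (i + 1 : ℕ) = -(1 - r) := by push_cast; linarith
    rw [h1, h2, abs_neg, abs_of_nonneg hr.1, abs_of_nonneg (by linarith [hr.2]),
      max_eq_right (by linarith [hr.2]), max_eq_right (by linarith [hr.1])]
    ring
  · rintro j - ⟨hj1, hj2⟩
    rw [max_eq_left, zero_mul]
    rcases lt_or_gt_of_ne hj1 with h | h
    · have : (j : ℝ) + 1 ≤ i := by exact_mod_cast h
      linarith [le_abs_self (t * n - j), hr.1]
    · have : (i : ℝ) + 2 ≤ j := by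
        have : i + 2 ≤ j := by omega
        exact_mod_cast this
      linarith [neg_abs_le (t * n - j), hr.2]
  · intro h
    exact absurd (Finset.mem_range.2 (by omega)) h
  · intro h
    exact absurd (Finset.mem_range.2 (by omega)) h

theorem bandPoint_eq_crossPoint (hn : 0 < n) (hi : i ≤ n) (ht : t * n = i) :
    bandPoint P Q n t y = crossPoint (P i) (Q i) y := by
  ext v
  rcases hi.lt_or_eq with h | rfl
  · rw [bandPoint_eq_interpolation (r := 0) h (by simp) (by simpa using ht)]
    ring
  · obtain ⟨m, rfl⟩ : ∃ m, i = m + 1 := ⟨i - 1, by omega⟩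
    rw [bandPoint_eq_interpolation (i := m) (r := 1) (by omega) (by simp)
      (by rw [ht]; push_cast; ring)]
    ring

theorem exists_mul_eq_nat_or (n : ℕ) (ht : t ∈ Icc (0 : ℝ) 1) :
    (∃ i ≤ n, t * n = i) ∨ ∃ i < n, ∃ r ∈ Ioo (0 : ℝ) 1, t * n = i + r := by
  have h0 : 0 ≤ t * n := mul_nonneg ht.1 (Nat.cast_nonneg n)
  have h1 : t * n ≤ n := mul_le_of_le_one_left (Nat.cast_nonneg n) ht.2
  have hf := Nat.floor_le h0
  have hf' := Nat.lt_floor_add_one (t * n)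
  rcases hf.eq_or_lt with h | h
  · left
    refine ⟨⌊t * n⌋₊, ?_, h.symm⟩
    exact_mod_cast hf.trans h1
  · right
    refine ⟨⌊t * n⌋₊, ?_, t * n - ⌊t * n⌋₊, ⟨by linarith, by linarith⟩, by ring⟩
    exact_mod_cast h.trans_le h1

theorem exists_mul_eq_add (ht : t ∈ Icc (0 : ℝ) 1) (hn : 0 < n) :
    ∃ i < n, ∃ r ∈ Icc (0 : ℝ) 1, t * n = i + r := by
  rcases exists_mul_eq_nat_or n ht with ⟨i, hi, h⟩ | ⟨i, hi, r, hr, h⟩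
  · rcases hi.lt_or_eq with h1 | rfl
    · exact ⟨i, h1, 0, by simp, by simpa using h⟩
    · obtain ⟨m, rfl⟩ : ∃ m, i = m + 1 := ⟨i - 1, by omega⟩
      exact ⟨m, by omega, 1, by simp, by rw [h]; push_cast; ring⟩
  · exact ⟨i, hi, r, Ioo_subset_Icc_self hr, h⟩

theorem bandPoint_one (hn : 0 < n) {v : V} (hP : ∀ i, P i = v) {t : ℝ}
    (ht : t ∈ Icc (0 : ℝ) 1) : bandPoint P Q n t 1 = Pi.single v 1 := by
  obtain ⟨i, hi, r, hr, hir⟩ := exists_mul_eq_add ht hn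
  ext u
  rw [bandPoint_eq_interpolation hi hr hir, hP, hP, Pi.single_apply]
  simp only [crossPoint]
  ring

theorem continuous_bandPoint (P Q : ℕ → V) (n : ℕ) (v : V) :
    Continuous fun p : ℝ × ℝ => bandPoint P Q n p.1 p.2 v := by
  unfold bandPoint crossPoint
  fun_prop

end bandPoint

/-! ### Barycentric coordinates, Γ_II and the identifications of the band. -/

namespace SurfaceTriangulation

variable {V : Type*} [Fintype V] [DecidableEq V] {M : Type*} [TopologicalSpace M]
  {T : SurfaceTriangulation V M} {τ : Set (ℤ → Finset V)}

variable (T) in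
/-- The barycentric coordinates of a point of `M`. -/
def coord (m : M) (v : V) : ℝ := (T.homeo.symm m).1 v

theorem continuous_coord (v : V) : Continuous fun m => T.coord m v :=
  (continuous_apply v).comp (continuous_subtype_val.comp T.homeo.symm.continuous)

theorem coord_injective : Function.Injective T.coord := fun _ _ h =>
  T.homeo.symm.injective (Subtype.ext h)

theorem coord_nonneg (m : M) (v : V) : 0 ≤ T.coord m v := (T.homeo.symm m).2.1.1 v

theorem sum_coord (m : M) : ∑ v, T.coord m v = 1 := (T.homeo.symm m).2.1.2

theorem exists_face_coord (m : M) : ∃ s ∈ T.faces, ∀ v, v ∉ s → T.coord m v = 0 :=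
  (T.homeo.symm m).2.2

theorem coord_homeo {x : V → ℝ} (hx : x ∈ geomRealization T.faces) :
    T.coord (T.homeo ⟨x, hx⟩) = x := by
  ext v
  simp [coord]

theorem coord_vertexPoint (v : V) : T.coord (T.vertexPoint v) = Pi.single v 1 := coord_homeo _

theorem mem_edgeArc {e : Finset V} {m : M} : m ∈ T.edgeArc e ↔ ∀ v, v ∉ e → T.coord m v = 0 := by
  constructor
  · rintro ⟨x, hx, rfl⟩ v hv
    simpa [coord] using hx v hv
  · intro h
    exact ⟨T.homeo.symm m, h, by simp⟩

/-- The support of the point has two elements, so it is no vertex; an edge of type II carrying it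
would be `{u, v}`. -/
theorem notMem_graphII {m : M} {u v : V} (he : T.IsEdgeI τ {u, v})
    (hm : ∀ w ∈ ({u, v} : Finset V), T.coord m w ≠ 0) : m ∉ T.graphII τ := by
  rintro (⟨w, -, rfl⟩ | ⟨e, hII, hme⟩)
  · have h : ∀ x ∈ ({u, v} : Finset V), x = w := by
      intro x hx
      by_contra hxw
      apply hm x hx
      rw [coord_vertexPoint, Pi.single_eq_of_ne hxw]
    exact he.ne ((h u (by simp)).trans (h v (by simp)).symm)
  · have hsub : ({u, v} : Finset V) ⊆ e := by
      intro x hx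
      by_contra hxe
      exact hm x hx (mem_edgeArc.1 hme x hxe)
    have := Finset.eq_of_subset_of_card_le hsub (by rw [hII.1.1, he.1.1])
    exact hII.2 (this ▸ he)

theorem vertexPoint_notMem_graphII {v : V} (hv : T.IsVertexI τ v) :
    T.vertexPoint v ∉ T.graphII τ := by
  rintro (⟨w, hw, h⟩ | ⟨e, hII, hme⟩)
  · have h1 := congrFun (congrArg T.coord h) v
    rw [coord_vertexPoint, coord_vertexPoint, Pi.single_eq_same] at h1
    have h2 : v = w := by
      by_contra hne
      rw [Pi.single_eq_of_ne hne] at h1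
      exact one_ne_zero h1
    exact hw (h2 ▸ hv)
  · have hve : v ∉ e := fun h => hII.2 (hv e hII.1 h)
    have := mem_edgeArc.1 hme v hve
    rw [coord_vertexPoint, Pi.single_eq_same] at this
    exact one_ne_zero this

namespace IsStrip

variable {P Q : ℕ → V} {S : ℕ → Finset V} {n : ℕ} {t y : ℝ}

theorem bandPoint_mem (h : T.IsStrip τ P Q S) (hn : 0 < n) (ht : t ∈ Icc (0 : ℝ) 1)
    (hy : y ∈ Icc (-1 : ℝ) 1) : bandPoint P Q n t y ∈ geomRealization T.faces := by
  obtain ⟨i, hi, r, hr, hir⟩ := exists_mul_eq_add ht hn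
  have hb := bandPoint_eq_interpolation (P := P) (Q := Q) (y := y) hi hr hir
  have hr' : 0 ≤ 1 - r := by linarith [hr.2]
  refine ⟨⟨fun v => ?_, ?_⟩, S i, h.face i, fun v hv => ?_⟩
  · rw [hb]
    exact add_nonneg (mul_nonneg hr' (crossPoint_nonneg hy v))
      (mul_nonneg hr.1 (crossPoint_nonneg hy v))
  · simp only [hb, Finset.sum_add_distrib, ← Finset.mul_sum, sum_crossPoint]
    ring
  · rw [hb, crossPoint_eq_zero fun hm => hv (h.edge_subset i hm),
      crossPoint_eq_zero fun hm => hv (h.succ_edge_subset i hm)]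
    ring

theorem bandPoint_ne_zero_iff (h : T.IsStrip τ P Q S) {i : ℕ} (hi : i < n) {r : ℝ}
    (hr : r ∈ Ioo (0 : ℝ) 1) (hir : t * n = i + r) (hy : y ∈ Ioo (-1 : ℝ) 1) {v : V} :
    bandPoint P Q n t y v ≠ 0 ↔ v ∈ S i := by
  rw [bandPoint_eq_interpolation hi (Ioo_subset_Icc_self hr) hir, h.face_eq, Finset.mem_union]
  have hr' : 0 < 1 - r := by linarith [hr.2]
  have h1 := mul_nonneg hr'.le (crossPoint_nonneg (p := P i) (q := Q i) (Ioo_subset_Icc_self hy) v)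
  have h2 := mul_nonneg hr.1.le (crossPoint_nonneg (p := P (i + 1)) (q := Q (i + 1))
    (Ioo_subset_Icc_self hy) v)
  constructor
  · intro hne
    by_contra hv
    rw [not_or] at hv
    rw [crossPoint_eq_zero hv.1, crossPoint_eq_zero hv.2] at hne
    simp at hne
  · rintro (hv | hv)
    · have := mul_pos hr' (crossPoint_pos hy hv)
      linarith
    · have := mul_pos hr.1 (crossPoint_pos hy hv)
      linarith

/-- The coordinate at the pivot `P i` is (1 + y)/2 and yields y; the one at `Q (i + 1)` is r(1 -
y)/2 and yields r as long as y < 1. -/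
theorem interpolation_injective_of_left (h : T.IsStrip τ P Q S) {i : ℕ} (hP : P (i + 1) = P i)
    (hQ : Q (i + 1) ≠ Q i) {r r' y' : ℝ} (hy : y < 1)
    (he : ∀ v, (1 - r) * crossPoint (P i) (Q i) y v +
      r * crossPoint (P (i + 1)) (Q (i + 1)) y v = (1 - r') * crossPoint (P i) (Q i) y' v +
      r' * crossPoint (P (i + 1)) (Q (i + 1)) y' v) : r = r' ∧ y = y' := by
  have h1 := h.ne i
  have h2 : P i ≠ Q (i + 1) := hP ▸ h.ne (i + 1)
  have e1 := he (P i)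
  have e2 := he (Q (i + 1))
  simp only [hP, crossPoint, h1, h2, h2.symm, hQ, if_true, if_false] at e1 e2
  have hyy : y = y' := by linarith
  subst hyy
  refine ⟨?_, rfl⟩
  have : (1 - y) * (r - r') = 0 := by linarith
  rcases mul_eq_zero.1 this with h3 | h3 <;> linarith

theorem interpolation_injective (h : T.IsStrip τ P Q S) (i : ℕ) {r r' y' : ℝ}
    (hy : y ∈ Ioo (-1 : ℝ) 1)
    (he : ∀ v, (1 - r) * crossPoint (P i) (Q i) y v +
      r * crossPoint (P (i + 1)) (Q (i + 1)) y v = (1 - r') * crossPoint (P i) (Q i) y' v +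
      r' * crossPoint (P (i + 1)) (Q (i + 1)) y' v) : r = r' ∧ y = y' := by
  rcases h.step i with ⟨h1, h2, -⟩ | ⟨h1, h2, -⟩
  · exact h.interpolation_injective_of_left h1 h2 hy.2 he
  · simp only [← crossPoint_swap (P i), ← crossPoint_swap (P (i + 1))] at he
    have := h.swap.interpolation_injective_of_left h1 h2 (by linarith [hy.1]) he
    exact ⟨this.1, neg_injective this.2⟩

theorem edge_subset_support (h : T.IsStrip τ P Q S) (hn : 0 < n) (ht : t ∈ Icc (0 : ℝ) 1)
    (hy : y ∈ Ioo (-1 : ℝ) 1) :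
    ∃ i ≤ n, ∀ v ∈ ({P i, Q i} : Finset V), bandPoint P Q n t y v ≠ 0 := by
  rcases exists_mul_eq_nat_or n ht with ⟨i, hi, hir⟩ | ⟨i, hi, r, hr, hir⟩
  · refine ⟨i, hi, fun v hv => ?_⟩
    rw [bandPoint_eq_crossPoint hn hi hir]
    exact (crossPoint_pos hy hv).ne'
  · exact ⟨i, hi.le, fun v hv => (h.bandPoint_ne_zero_iff hi hr hir hy).2 (h.edge_subset i hv)⟩

/-- Supports decide everything: two vertices on a crossed edge, three strictly between two of them.
Equal points therefore lie on the same edge or in the same face, and within one period an edge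
recurs only at the two ends. -/
theorem bandPoint_eq (h : T.IsStrip τ P Q S) (hn : 0 < n) (hinj : InjOn S (Iio n))
    (hSn : S n = S 0) {t' y' : ℝ} (ht : t ∈ Icc (0 : ℝ) 1) (ht' : t' ∈ Icc (0 : ℝ) 1)
    (hy : y ∈ Ioo (-1 : ℝ) 1) (hy' : y' ∈ Ioo (-1 : ℝ) 1)
    (he : bandPoint P Q n t y = bandPoint P Q n t' y') :
    (t = t' ∧ y = y') ∨
      (t = 0 ∧ t' = 1 ∧ crossPoint (P 0) (Q 0) y = crossPoint (P n) (Q n) y') ∨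
      (t = 1 ∧ t' = 0 ∧ crossPoint (P n) (Q n) y = crossPoint (P 0) (Q 0) y') := by
  have hnR : (n : ℝ) ≠ 0 := by exact_mod_cast hn.ne'
  rcases exists_mul_eq_nat_or n ht with ⟨i, hi, hir⟩ | ⟨i, hi, r, hr, hir⟩ <;>
    rcases exists_mul_eq_nat_or n ht' with ⟨j, hj, hjr⟩ | ⟨j, hj, r', hr', hjr⟩
  · rw [bandPoint_eq_crossPoint hn hi hir, bandPoint_eq_crossPoint hn hj hjr] at he
    have hE : ({P i, Q i} : Finset V) = {P j, Q j} := by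
      ext v
      rw [← crossPoint_ne_zero_iff hy, ← crossPoint_ne_zero_iff hy', he]
    rcases lt_trichotomy i j with hlt | rfl | hlt
    · obtain ⟨rfl, rfl⟩ := h.eq_of_edge_eq hinj hSn hlt hj hE
      right; left
      refine ⟨?_, ?_, he⟩
      · simpa [hnR] using hir
      · simpa [hnR] using hjr
    · left
      exact ⟨mul_right_cancel₀ hnR (hir.trans hjr.symm), (crossPoint_eq_iff (h.ne i)).1 he⟩
    · obtain ⟨rfl, rfl⟩ := h.eq_of_edge_eq hinj hSn hlt hi hE.symm
      right; right
      refine ⟨?_, ?_, he⟩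
      · simpa [hnR] using hir
      · simpa [hnR] using hjr
  · exfalso
    have hE : ({P i, Q i} : Finset V) = S j := by
      ext v
      rw [← crossPoint_ne_zero_iff hy, ← h.bandPoint_ne_zero_iff hj hr' hjr hy', ← he,
        bandPoint_eq_crossPoint hn hi hir]
    have h1 := (h.edge i).1.1
    rw [hE, T.card_face _ (h.face j)] at h1
    omega
  · exfalso
    have hE : ({P j, Q j} : Finset V) = S i := by
      ext v
      rw [← crossPoint_ne_zero_iff hy', ← h.bandPoint_ne_zero_iff hi hr hir hy, he,
        bandPoint_eq_crossPoint hn hj hjr]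
    have h1 := (h.edge j).1.1
    rw [hE, T.card_face _ (h.face i)] at h1
    omega
  · have hS : S i = S j := by
      ext v
      rw [← h.bandPoint_ne_zero_iff hi hr hir hy, ← h.bandPoint_ne_zero_iff hj hr' hjr hy', he]
    obtain rfl := hinj hi hj hS
    have := h.interpolation_injective i (r := r) (r' := r') (y' := y') hy fun v => by
      rw [← bandPoint_eq_interpolation hi (Ioo_subset_Icc_self hr) hir,
        ← bandPoint_eq_interpolation hi (Ioo_subset_Icc_self hr') hjr, he]
    left
    refine ⟨mul_right_cancel₀ hnR ?_, this.2⟩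
    rw [hir, hjr, this.1]

theorem exists_bandPoint_eq_of_left (h : T.IsStrip τ P Q S) {i : ℕ} (hi : i < n)
    (hP : P (i + 1) = P i) (hQ : Q (i + 1) ≠ Q i) {x : V → ℝ} (hx : ∀ v, 0 ≤ x v)
    (hx1 : ∑ v, x v = 1) (hxS : ∀ v, v ∉ S i → x v = 0) :
    ∃ t ∈ Icc (0 : ℝ) 1, ∃ y ∈ Icc (-1 : ℝ) 1, bandPoint P Q n t y = x := by
  have hnR : (0 : ℝ) < n := by exact_mod_cast (Nat.zero_le i).trans_lt hi
  have h1 := h.ne i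
  have h2 : P i ≠ Q (i + 1) := hP ▸ h.ne (i + 1)
  have hS := h.face_eq_of_left hP hQ
  have hsum : x (P i) + x (Q i) + x (Q (i + 1)) = 1 := by
    rw [← hx1, ← Finset.sum_subset (Finset.subset_univ (S i)) fun v _ hv => hxS v hv, hS,
      Finset.sum_insert (by simp [h1, h2]), Finset.sum_pair hQ.symm, add_assoc]
  -- Inverts the interpolation with y = 2x(P) - 1. At the pivot itself, x(P) = 1, any r would do and
  -- 0 is taken.
  obtain ⟨r, hr, hrx⟩ : ∃ r ∈ Icc (0 : ℝ) 1, r * (1 - x (P i)) = x (Q (i + 1)) := by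
    rcases eq_or_ne (x (P i)) 1 with h3 | h3
    · exact ⟨0, by simp, by linarith [hx (Q i), hx (Q (i + 1))]⟩
    · have h4 : 0 < 1 - x (P i) := by
        apply lt_of_le_of_ne (by linarith [hx (Q i), hx (Q (i + 1))])
        intro h5
        exact h3 (by linarith)
      refine ⟨x (Q (i + 1)) / (1 - x (P i)), ⟨div_nonneg (hx _) h4.le, ?_⟩, ?_⟩
      · rw [div_le_one h4]
        linarith [hx (Q i)]
      · field_simp
  have hi1 : (i : ℝ) + 1 ≤ n := by exact_mod_cast hi
  have ht : (i + r) / n * n = i + r := by field_simp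
  refine ⟨(i + r) / n, ⟨div_nonneg (add_nonneg (Nat.cast_nonneg i) hr.1) hnR.le, ?_⟩,
    2 * x (P i) - 1, ⟨by linarith [hx (P i)], by linarith [hx (Q i), hx (Q (i + 1))]⟩, ?_⟩
  · rw [div_le_one hnR]
    linarith [hr.2]
  · ext v
    rw [bandPoint_eq_interpolation hi hr ht, hP]
    by_cases hv : v ∈ S i
    · rw [hS] at hv
      simp only [Finset.mem_insert, Finset.mem_singleton] at hv
      rcases hv with rfl | rfl | rfl
      · simp only [crossPoint, h1, h2, if_true, if_false]
        ring
      · simp only [crossPoint, h1.symm, hQ.symm, if_true, if_false]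
        linarith
      · simp only [crossPoint, h2.symm, hQ, if_true, if_false]
        linarith
    · rw [hxS v hv]
      have hv' := hv
      rw [hS] at hv
      simp only [Finset.mem_insert, Finset.mem_singleton, not_or] at hv
      simp [crossPoint, hv.1, hv.2.1, hv.2.2]

theorem exists_bandPoint_eq (h : T.IsStrip τ P Q S) {i : ℕ} (hi : i < n) {x : V → ℝ}
    (hx : ∀ v, 0 ≤ x v) (hx1 : ∑ v, x v = 1) (hxS : ∀ v, v ∉ S i → x v = 0) :
    ∃ t ∈ Icc (0 : ℝ) 1, ∃ y ∈ Icc (-1 : ℝ) 1, bandPoint P Q n t y = x := by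
  rcases h.step i with ⟨h1, h2, -⟩ | ⟨h1, h2, -⟩
  · exact h.exists_bandPoint_eq_of_left hi h1 h2 hx hx1 hxS
  · obtain ⟨t, ht, y, hy, he⟩ := h.swap.exists_bandPoint_eq_of_left hi h1 h2 hx hx1 hxS
    refine ⟨t, ht, -y, ⟨by linarith [hy.2], by linarith [hy.1]⟩, ?_⟩
    rw [bandPoint_swap, he]

/-- Over each face the line y = -1 either runs along the side of type II, when `Q` moves, or stays
at the vertex `Q i`, when `Q` is the pivot. Only the second case needs the hypothesis on vertices.
-/
theorem mem_graphII_of_neg_one (h : T.IsStrip τ P Q S) (hn : 0 < n) (ht : t ∈ Icc (0 : ℝ) 1)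
    (hQ : ∀ i, Q (i + 1) = Q i → ¬ T.IsVertexI τ (Q i)) {m : M}
    (hm : T.coord m = bandPoint P Q n t (-1)) : m ∈ T.graphII τ := by
  obtain ⟨i, hi, r, hr, hir⟩ := exists_mul_eq_add ht hn
  rcases h.step i with ⟨h1, h2, h3⟩ | ⟨h1, h2, -⟩
  · refine Or.inr ⟨{Q i, Q (i + 1)}, h3, mem_edgeArc.2 fun v hv => ?_⟩
    simp only [Finset.mem_insert, Finset.mem_singleton, not_or] at hv
    rw [hm, bandPoint_eq_interpolation hi hr hir]
    simp [crossPoint, hv.1, hv.2]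
  · refine Or.inl ⟨Q i, hQ i h1, coord_injective (T := T) ?_⟩
    rw [hm, coord_vertexPoint]
    ext v
    rw [bandPoint_eq_interpolation hi hr hir, h1, Pi.single_apply]
    simp only [crossPoint]
    ring

theorem mem_graphII_of_one (h : T.IsStrip τ P Q S) (hn : 0 < n) (ht : t ∈ Icc (0 : ℝ) 1)
    (hP : ∀ i, P (i + 1) = P i → ¬ T.IsVertexI τ (P i)) {m : M}
    (hm : T.coord m = bandPoint P Q n t 1) : m ∈ T.graphII τ :=
  h.swap.mem_graphII_of_neg_one hn ht hP (hm.trans (bandPoint_swap P Q n t 1).symm)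

theorem notMem_graphII_of_mem_Ioo (h : T.IsStrip τ P Q S) (hn : 0 < n) (ht : t ∈ Icc (0 : ℝ) 1)
    (hy : y ∈ Ioo (-1 : ℝ) 1) {m : M} (hm : T.coord m = bandPoint P Q n t y) :
    m ∉ T.graphII τ := by
  obtain ⟨i, -, hi⟩ := h.edge_subset_support hn ht hy
  exact notMem_graphII (h.edge i) (hm ▸ hi)

end IsStrip


theorem isClosed_setOf_support_subset (s : Finset V) :
    IsClosed {m | ∀ v, v ∉ s → T.coord m v = 0} := by
  simp only [ofPred_forall]
  exact isClosed_iInter fun v => isClosed_iInter fun _ =>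
    isClosed_eq (continuous_coord v) continuous_const

/-- Every neighbourhood of a vertex of a face contains other points of the face. -/
theorem exists_mem_nhds_vertexPoint {v : V} {s : Finset V} (hs : s ∈ T.faces) (hv : v ∈ s)
    {W : Set M} (hW : W ∈ 𝓝 (T.vertexPoint v)) :
    ∃ z ∈ W, z ≠ T.vertexPoint v ∧ ∀ u, u ∉ s → T.coord z u = 0 := by
  obtain ⟨w, hw, hwv⟩ := Finset.exists_mem_ne (by rw [T.card_face s hs]; norm_num) v
  have hsub : ({v, w} : Finset V) ⊆ s := by simp [Finset.insert_subset_iff, hv, hw]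
  have hmem : ∀ y : Icc (-1 : ℝ) 1, crossPoint v w y ∈ geomRealization T.faces := fun y =>
    ⟨⟨fun u => crossPoint_nonneg y.2 u, sum_crossPoint v w y⟩, s, hs,
      fun u hu => crossPoint_eq_zero fun h => hu (hsub h)⟩
  let g : Icc (-1 : ℝ) 1 → M := fun y => T.homeo ⟨crossPoint v w y, hmem y⟩
  have hg : Continuous g := by
    refine T.homeo.continuous.comp (Continuous.subtype_mk (continuous_pi fun u => ?_) _)
    unfold crossPoint
    fun_prop
  have hg1 : g ⟨1, by norm_num⟩ = T.vertexPoint v := by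
    apply coord_injective (T := T)
    rw [coord_homeo, coord_vertexPoint]
    ext u
    simp [crossPoint, Pi.single_apply]
  -- Points of an edge at the vertex, different from the vertex and converging to it.
  let a : ℕ → Icc (-1 : ℝ) 1 := fun k => ⟨1 - 1 / ((k : ℝ) + 1), by
    have h1 : 0 < 1 / ((k : ℝ) + 1) := Nat.one_div_pos_of_nat
    have h2 : 1 / ((k : ℝ) + 1) ≤ 1 := by
      rw [div_le_one (by positivity)]
      linarith [(Nat.cast_nonneg k : (0 : ℝ) ≤ k)]
    constructor <;> linarith⟩
  have ha : Filter.Tendsto a Filter.atTop (𝓝 ⟨1, by norm_num⟩) := by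
    rw [tendsto_subtype_rng]
    change Filter.Tendsto (fun k : ℕ => 1 - 1 / ((k : ℝ) + 1)) Filter.atTop (𝓝 1)
    simpa using (tendsto_one_div_add_atTop_nhds_zero_nat (𝕜 := ℝ)).const_sub 1
  have hga : Filter.Tendsto (fun k => g (a k)) Filter.atTop (𝓝 (T.vertexPoint v)) := by
    rw [← hg1]
    exact (hg.tendsto _).comp ha
  obtain ⟨k, hk⟩ := (hga.eventually hW).exists
  refine ⟨g (a k), hk, fun h => ?_, fun u hu => ?_⟩
  · have h1 := congrFun (congrArg T.coord h) v
    rw [coord_homeo, coord_vertexPoint, Pi.single_eq_same, crossPoint_left hwv.symm] at h1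
    have h2 : 0 < 1 / ((k : ℝ) + 1) := Nat.one_div_pos_of_nat
    have h3 : (1 + (1 - 1 / ((k : ℝ) + 1))) / 2 = 1 := h1
    linarith
  · rw [coord_homeo]
    exact crossPoint_eq_zero fun h => hu (hsub h)

/-! ### The component swept out by a strip. -/

namespace IsStrip

variable {P Q : ℕ → V} {S : ℕ → Finset V} {n : ℕ}

/-- The map of the band to `M`. -/
noncomputable def bandMap (h : T.IsStrip τ P Q S) (hn : 0 < n) (p : Icc (0 : ℝ) 1 × Icc (-1 : ℝ) 1) : M :=
  T.homeo ⟨bandPoint P Q n p.1 p.2, h.bandPoint_mem hn p.1.2 p.2.2⟩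

theorem coord_bandMap (h : T.IsStrip τ P Q S) (hn : 0 < n)
    (p : Icc (0 : ℝ) 1 × Icc (-1 : ℝ) 1) :
    T.coord (h.bandMap hn p) = bandPoint P Q n p.1 p.2 := coord_homeo _

theorem continuous_bandMap (h : T.IsStrip τ P Q S) (hn : 0 < n) :
    Continuous (h.bandMap hn) := by
  refine T.homeo.continuous.comp (Continuous.subtype_mk (continuous_pi fun v => ?_) _)
  exact (continuous_bandPoint P Q n v).comp
    ((continuous_subtype_val.comp continuous_fst).prodMk
      (continuous_subtype_val.comp continuous_snd))

theorem mem_range_bandMap (h : T.IsStrip τ P Q S) (hn : 0 < n) {i : ℕ} (hi : i < n) {m : M}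
    (hm : ∀ v, v ∉ S i → T.coord m v = 0) : m ∈ range (h.bandMap hn) := by
  obtain ⟨t, ht, y, hy, he⟩ := h.exists_bandPoint_eq hi (coord_nonneg m) (sum_coord m) hm
  exact ⟨(⟨t, ht⟩, ⟨y, hy⟩), coord_injective ((h.coord_bandMap hn _).trans he)⟩

variable (T S n) in
/-- The union of the faces that the walk does not meet in its first `n` steps. -/
def otherFaces : Set M :=
  ⋃ s ∈ T.faces.filter fun s => ∀ k < n, s ≠ S k, {m | ∀ v, v ∉ s → T.coord m v = 0}

theorem isClosed_otherFaces : IsClosed (otherFaces T S n) :=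
  isClosed_biUnion_finset fun s _ => isClosed_setOf_support_subset s

theorem mem_otherFaces {m : M} : m ∈ otherFaces T S n ↔
    ∃ s ∈ T.faces, (∀ k < n, s ≠ S k) ∧ ∀ v, v ∉ s → T.coord m v = 0 := by
  simp [otherFaces, and_assoc]

theorem mem_range_or_mem_otherFaces (h : T.IsStrip τ P Q S) (hn : 0 < n) (m : M) :
    m ∈ range (h.bandMap hn) ∪ otherFaces T S n := by
  obtain ⟨s, hs, hm⟩ := exists_face_coord (T := T) m
  by_cases hk : ∃ k < n, s = S k
  · obtain ⟨k, hk, rfl⟩ := hk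
    exact Or.inl (h.mem_range_bandMap hn hk hm)
  · push Not at hk
    exact Or.inr (mem_otherFaces.2 ⟨s, hs, hk, hm⟩)

/-- The support of the point contains a crossed edge, and both faces at that edge belong to the
strip. -/
theorem bandMap_notMem_otherFaces (h : T.IsStrip τ P Q S) (hn : 0 < n) (hSn : S n = S 0)
    (hPQ : (P n = P 0 ∧ Q n = Q 0) ∨ (P n = Q 0 ∧ Q n = P 0))
    {p : Icc (0 : ℝ) 1 × Icc (-1 : ℝ) 1} (hp : (p.2 : ℝ) ∈ Ioo (-1 : ℝ) 1) :
    h.bandMap hn p ∉ otherFaces T S n := by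
  intro hm
  obtain ⟨s, hs, hk, hm⟩ := mem_otherFaces.1 hm
  obtain ⟨i, hi, hsub⟩ := h.edge_subset_support hn p.1.2 hp
  obtain ⟨k, hkn, hsk⟩ := h.exists_eq_of_edge_subset hn hPQ hSn hi hs fun v hv => by
    by_contra hvs
    apply hsub v hv
    rw [← h.coord_bandMap hn p, hm v hvs]
  exact hk k hkn hsk

theorem bandMap_ne_vertexPoint (h : T.IsStrip τ P Q S) (hn : 0 < n)
    {p : Icc (0 : ℝ) 1 × Icc (-1 : ℝ) 1} (hp : (p.2 : ℝ) ∈ Ioo (-1 : ℝ) 1) (w : V) :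
    h.bandMap hn p ≠ T.vertexPoint w := by
  intro he
  obtain ⟨i, -, hsub⟩ := h.edge_subset_support hn p.1.2 hp
  have heq : ∀ v ∈ ({P i, Q i} : Finset V), v = w := by
    intro v hv
    by_contra hvw
    apply hsub v hv
    rw [← h.coord_bandMap hn p, he, coord_vertexPoint, Pi.single_eq_of_ne hvw]
  exact h.ne i ((heq (P i) (by simp)).trans (heq (Q i) (by simp)).symm)

/-- If the preimage of the complement of `Γ_II` is a product with an interval `J`, then this
product is mapped onto a component as a quotient map. -/
theorem exists_isQuotientMap_component [T2Space M] (h : T.IsStrip τ P Q S) (hn : 0 < n)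
    {J : Set ℝ} (hJ : J ⊆ Icc (-1) 1) (hJc : IsPreconnected J)
    (hU : ∀ p, h.bandMap hn p ∈ (T.graphII τ)ᶜ ↔ (p.2 : ℝ) ∈ J)
    (hL : ∀ p, (p.2 : ℝ) ∈ J → h.bandMap hn p ∉ otherFaces T S n) {x : M}
    (hx : x ∈ (T.graphII τ)ᶜ) (hxS : ∀ v, v ∉ S 0 → T.coord x v = 0) :
    ∃ f : Icc (0 : ℝ) 1 × J → connectedComponentIn (T.graphII τ)ᶜ x, IsQuotientMap f ∧
      ∀ d, (f d : M) = h.bandMap hn (d.1, inclusion hJ d.2) := by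
  have hpJ : PreconnectedSpace J := Subtype.preconnectedSpace hJc
  let j : Icc (0 : ℝ) 1 × J → Icc (0 : ℝ) 1 × Icc (-1 : ℝ) 1 := Prod.map id (inclusion hJ)
  have hj : IsEmbedding j := IsEmbedding.id.prodMap (IsEmbedding.inclusion _)
  have hF := h.continuous_bandMap hn
  have hrj : range j = h.bandMap hn ⁻¹' ((T.graphII τ)ᶜ ∩ range (h.bandMap hn)) := by
    ext p
    rw [mem_preimage, mem_inter_iff, hU, and_iff_left (mem_range_self p)]
    simp only [j, range_prodMap, mem_prod, range_id, mem_univ, true_and, range_inclusion]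
    rfl
  have hrange : (T.graphII τ)ᶜ ∩ range (h.bandMap hn) = range (h.bandMap hn ∘ j) := by
    rw [range_comp, hrj, image_preimage_eq_inter_range, inter_assoc, inter_self]
  have hC : connectedComponentIn (T.graphII τ)ᶜ x =
      (T.graphII τ)ᶜ ∩ range (h.bandMap hn) := by
    refine connectedComponentIn_eq_of_closed_cover (isCompact_range hF).isClosed
      (isClosed_otherFaces (T := T) (S := S) (n := n))
      (fun m _ => h.mem_range_or_mem_otherFaces hn m) ?_ ?_ ⟨hx, h.mem_range_bandMap hn hn hxS⟩
    · rw [eq_empty_iff_forall_notMem]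
      rintro _ ⟨⟨hm, p, rfl⟩, hmL⟩
      exact hL p ((hU p).1 hm) hmL
    · rw [hrange]
      exact isPreconnected_range (hF.comp hj.continuous)
  rw [hC]
  have hm : ∀ d, h.bandMap hn (j d) ∈ (T.graphII τ)ᶜ ∩ range (h.bandMap hn) := fun d =>
    ⟨(hU _).2 d.2.2, mem_range_self _⟩
  exact ⟨_, isQuotientMap_codRestrict hF hj hrj inter_subset_right hm, fun d => rfl⟩

/-- A walk that does not turn around a vertex sweeps out a cylinder or a Möbius strip. -/
theorem component_of_no_vertexI [T2Space M] (h : T.IsStrip τ P Q S) (hn : 0 < n)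
    (hinj : InjOn S (Iio n)) (hSn : S n = S 0)
    (hPQ : (P n = P 0 ∧ Q n = Q 0) ∨ (P n = Q 0 ∧ Q n = P 0))
    (hv : ∀ i, ∀ v ∈ S i, ¬ T.IsVertexI τ v) {x : M} (hx : x ∈ (T.graphII τ)ᶜ)
    (hxS : ∀ v, v ∉ S 0 → T.coord x v = 0) :
    (Nonempty (connectedComponentIn (T.graphII τ)ᶜ x ≃ₜ OpenMobiusStrip) ∨
      Nonempty (connectedComponentIn (T.graphII τ)ᶜ x ≃ₜ OpenCylinder)) ∧
      ∀ v, T.vertexPoint v ∉ connectedComponentIn (T.graphII τ)ᶜ x := by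
  have hU : ∀ p, h.bandMap hn p ∈ (T.graphII τ)ᶜ ↔ (p.2 : ℝ) ∈ Ioo (-1 : ℝ) 1 := by
    intro p
    constructor
    · intro hp
      rcases p.2.2.1.eq_or_lt with h1 | h1
      · refine absurd (h.mem_graphII_of_neg_one hn p.1.2
          (fun i _ => hv i _ (h.right_mem i)) ?_) hp
        rw [h.coord_bandMap, ← h1]
      rcases p.2.2.2.eq_or_lt with h2 | h2
      · refine absurd (h.mem_graphII_of_one hn p.1.2 (fun i _ => hv i _ (h.left_mem i)) ?_) hp
        rw [h.coord_bandMap, h2]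
      · exact ⟨h1, h2⟩
    · intro hp
      exact h.notMem_graphII_of_mem_Ioo hn p.1.2 hp (h.coord_bandMap hn p)
  obtain ⟨f, hf, hfb⟩ := h.exists_isQuotientMap_component hn Ioo_subset_Icc_self
    isPreconnected_Ioo hU (fun p hp => h.bandMap_notMem_otherFaces hn hSn hPQ hp) hx hxS
  have hnR : (n : ℝ) ≠ 0 := by exact_mod_cast hn.ne'
  have hfeq : ∀ p q, f p = f q ↔ bandPoint P Q n p.1 p.2 = bandPoint P Q n q.1 q.2 := by
    intro p q
    rw [Subtype.ext_iff, hfb, hfb, ← (coord_injective (T := T)).eq_iff, h.coord_bandMap,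
      h.coord_bandMap]
  have h0 : ∀ y, bandPoint P Q n 0 y = crossPoint (P 0) (Q 0) y := fun y =>
    bandPoint_eq_crossPoint hn hn.le (by simp)
  have h1 : ∀ y, bandPoint P Q n 1 y = crossPoint (P n) (Q n) y := fun y =>
    bandPoint_eq_crossPoint hn le_rfl (by simp)
  constructor
  · rcases hPQ with ⟨hP, hQ⟩ | ⟨hP, hQ⟩
    · right
      refine nonempty_homeomorph_cylinder hf fun p q => ?_
      rw [hfeq]
      constructor
      · intro he
        rcases h.bandPoint_eq hn hinj hSn p.1.2 q.1.2 p.2.2 q.2.2 he with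
          ⟨ht, hy⟩ | ⟨ht, ht', hc⟩ | ⟨ht, ht', hc⟩
        · exact ⟨hy, Or.inl ht⟩
        · rw [hP, hQ, crossPoint_eq_iff (h.ne 0)] at hc
          exact ⟨hc, Or.inr (Or.inl ⟨ht, ht'⟩)⟩
        · rw [hP, hQ, crossPoint_eq_iff (h.ne 0)] at hc
          exact ⟨hc, Or.inr (Or.inr ⟨ht, ht'⟩)⟩
      · rintro ⟨hy, ht | ⟨ht, ht'⟩ | ⟨ht, ht'⟩⟩
        · rw [hy, ht]
        · rw [ht, ht', h0, h1, hP, hQ, hy]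
        · rw [ht, ht', h0, h1, hP, hQ, hy]
    · left
      -- Exchanging the ends of the closing segment reverses its parameter: this is the Möbius
      -- gluing.
      have hc0 : ∀ y z : ℝ, crossPoint (P 0) (Q 0) y = crossPoint (P n) (Q n) z ↔ z = -y := by
        intro y z
        rw [hP, hQ, ← crossPoint_swap, crossPoint_eq_iff (h.ne 0).symm, eq_comm]
      refine nonempty_homeomorph_mobius hf fun p q => ?_
      rw [hfeq]
      constructor
      · intro he
        rcases h.bandPoint_eq hn hinj hSn p.1.2 q.1.2 p.2.2 q.2.2 he with
          ht | ⟨ht, ht', hc⟩ | ⟨ht, ht', hc⟩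
        · exact Or.inl ht
        · rw [hc0] at hc
          exact Or.inr ⟨hc, Or.inl ⟨ht, ht'⟩⟩
        · rw [eq_comm, hc0] at hc
          exact Or.inr ⟨by linarith, Or.inr ⟨ht, ht'⟩⟩
      · rintro (⟨ht, hy⟩ | ⟨hy, ⟨ht, ht'⟩ | ⟨ht, ht'⟩⟩)
        · rw [hy, ht]
        · rw [ht, ht', h0, h1, hc0, hy]
        · rw [ht, ht', h0, h1, eq_comm, hc0, hy, neg_neg]
  · intro v hvC
    obtain ⟨d, hd⟩ := hf.surjective ⟨_, hvC⟩
    have := hfb d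
    rw [hd] at this
    exact h.bandMap_ne_vertexPoint hn d.2.2 v this.symm

theorem bandPoint_apply_vertex (h : T.IsStrip τ P Q S) (hn : 0 < n) {v : V} (hP : ∀ i, P i = v)
    {t : ℝ} (ht : t ∈ Icc (0 : ℝ) 1) (y : ℝ) : bandPoint P Q n t y v = (1 + y) / 2 := by
  obtain ⟨i, hi, r, hr, hir⟩ := exists_mul_eq_add ht hn
  have h1 := h.ne i
  have h2 := h.ne (i + 1)
  rw [hP] at h1 h2
  rw [bandPoint_eq_interpolation hi hr hir, hP, hP, crossPoint_left h1, crossPoint_left h2]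
  ring

/-- A walk around a vertex of type I meets all faces at this vertex. -/
theorem vertexPoint_notMem_otherFaces [T2Space M] [ChartedSpace (EuclideanSpace ℝ (Fin 2)) M]
    (h : T.IsStrip τ P Q S) (hn : 0 < n) (hSn : S n = S 0)
    (hPQ : (P n = P 0 ∧ Q n = Q 0) ∨ (P n = Q 0 ∧ Q n = P 0)) {v : V} (hP : ∀ i, P i = v) :
    T.vertexPoint v ∉ otherFaces T S n := by
  intro hvL
  obtain ⟨s, hs, hk, hvs⟩ := mem_otherFaces.1 hvL
  have hvs' : v ∈ s := by
    by_contra hv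
    have := hvs v hv
    rw [coord_vertexPoint, Pi.single_eq_same] at this
    exact one_ne_zero this
  -- Inside the open star of v, where y > -1, the band and the other faces could meet only at v, yet
  -- both accumulate there: v would separate its neighbourhood.
  refine not_separated_by_point (m := T.vertexPoint v) (A := range (h.bandMap hn))
    (B := otherFaces T S n) (O := {m | 0 < T.coord m v})
    (isCompact_range (h.continuous_bandMap hn)).isClosed isClosed_otherFaces
    ((isOpen_lt continuous_const (continuous_coord v)).mem_nhds ?_)
    (fun m _ => h.mem_range_or_mem_otherFaces hn m) ?_ ?_ ?_
  · change 0 < T.coord _ v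
    rw [coord_vertexPoint, Pi.single_eq_same]
    exact one_pos
  · rintro _ ⟨⟨⟨p, rfl⟩, hpL⟩, hpO⟩
    have hpv : 0 < T.coord (h.bandMap hn p) v := hpO
    rw [h.coord_bandMap, h.bandPoint_apply_vertex hn hP p.1.2] at hpv
    rcases p.2.2.2.eq_or_lt with h2 | h2
    · apply coord_injective (T := T)
      rw [h.coord_bandMap, coord_vertexPoint, h2, bandPoint_one hn hP p.1.2]
    · exact absurd hpL (h.bandMap_notMem_otherFaces hn hSn hPQ ⟨by linarith, h2⟩)
  · intro W hW
    obtain ⟨z, hzW, hzv, hz⟩ := exists_mem_nhds_vertexPoint (h.face 0) (hP 0 ▸ h.left_mem 0) hW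
    exact ⟨z, hzW, hzv, h.mem_range_bandMap hn hn hz⟩
  · intro W hW
    obtain ⟨z, hzW, hzv, hz⟩ := exists_mem_nhds_vertexPoint hs hvs' hW
    exact ⟨z, hzW, hzv, mem_otherFaces.2 ⟨s, hs, hk, hz⟩⟩

/-- A walk around a vertex of type I sweeps out a disk. -/
theorem component_of_vertexI [T2Space M] [ChartedSpace (EuclideanSpace ℝ (Fin 2)) M]
    (h : T.IsStrip τ P Q S) (hn : 0 < n) (hinj : InjOn S (Iio n)) (hSn : S n = S 0)
    (hPQ : (P n = P 0 ∧ Q n = Q 0) ∨ (P n = Q 0 ∧ Q n = P 0)) {v : V}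
    (hv : T.IsVertexI τ v) (hP : ∀ i, P i = v) {x : M} (hx : x ∈ (T.graphII τ)ᶜ)
    (hxS : ∀ v, v ∉ S 0 → T.coord x v = 0) :
    Nonempty (connectedComponentIn (T.graphII τ)ᶜ x ≃ₜ OpenDisk) ∧
      ∀ w, T.vertexPoint w ∈ connectedComponentIn (T.graphII τ)ᶜ x ↔ w = v := by
  have hone : ∀ p : Icc (0 : ℝ) 1 × Icc (-1 : ℝ) 1, (p.2 : ℝ) = 1 →
      h.bandMap hn p = T.vertexPoint v := by
    intro p hp
    apply coord_injective (T := T)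
    rw [h.coord_bandMap, coord_vertexPoint, hp, bandPoint_one hn hP p.1.2]
  have hU : ∀ p, h.bandMap hn p ∈ (T.graphII τ)ᶜ ↔ (p.2 : ℝ) ∈ Ioc (-1 : ℝ) 1 := by
    intro p
    constructor
    · intro hp
      rcases p.2.2.1.eq_or_lt with h1 | h1
      · refine absurd (h.mem_graphII_of_neg_one hn p.1.2 (fun i hi hvi => ?_) ?_) hp
        -- The pivot is always v on the `P` side, so a step that fixes `Q` cannot occur.
        · have h3 := h.step i
          rw [hP, hP, hi] at h3
          simp at h3
        · rw [h.coord_bandMap, ← h1]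
      · exact ⟨h1, p.2.2.2⟩
    · intro hp
      rcases hp.2.eq_or_lt with h2 | h2
      · rw [hone p h2]
        exact vertexPoint_notMem_graphII hv
      · exact h.notMem_graphII_of_mem_Ioo hn p.1.2 ⟨hp.1, h2⟩ (h.coord_bandMap hn p)
  have hL : ∀ p, (p.2 : ℝ) ∈ Ioc (-1 : ℝ) 1 → h.bandMap hn p ∉ otherFaces T S n := by
    intro p hp
    rcases hp.2.eq_or_lt with h2 | h2
    · rw [hone p h2]
      exact h.vertexPoint_notMem_otherFaces hn hSn hPQ hP
    · exact h.bandMap_notMem_otherFaces hn hSn hPQ ⟨hp.1, h2⟩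
  obtain ⟨f, hf, hfb⟩ := h.exists_isQuotientMap_component hn Ioc_subset_Icc_self
    isPreconnected_Ioc hU hL hx hxS
  have hfeq : ∀ p q, f p = f q ↔ bandPoint P Q n p.1 p.2 = bandPoint P Q n q.1 q.2 := by
    intro p q
    rw [Subtype.ext_iff, hfb, hfb, ← (coord_injective (T := T)).eq_iff, h.coord_bandMap,
      h.coord_bandMap]
  -- A flipped closing would put v at both ends of the initial edge.
  have hPQ' : P n = P 0 ∧ Q n = Q 0 := by
    rcases hPQ with hPQ | ⟨h1, h2⟩
    · exact hPQ
    · exact absurd ((hP 0).trans ((hP n).symm.trans h1)) (h.ne 0)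
  have h01 : ∀ y, bandPoint P Q n 0 y = bandPoint P Q n 1 y := by
    intro y
    rw [bandPoint_eq_crossPoint (i := 0) hn hn.le (by simp),
      bandPoint_eq_crossPoint (i := n) hn le_rfl (by simp), hPQ'.1, hPQ'.2]
  refine ⟨nonempty_homeomorph_disk hf fun p q => ?_, fun w => ⟨fun hw => ?_, ?_⟩⟩
  · rw [hfeq]
    constructor
    · intro he
      -- The coordinate at v recovers y on the whole band, including y = 1, where `bandPoint_eq`
      -- does not apply.
      have hy : (p.2 : ℝ) = q.2 := by
        have := congrFun he v
        rw [h.bandPoint_apply_vertex hn hP p.1.2, h.bandPoint_apply_vertex hn hP q.1.2] at this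
        linarith
      refine ⟨hy, ?_⟩
      rcases p.2.2.2.eq_or_lt with h2 | h2
      · exact Or.inl h2
      · right
        rcases h.bandPoint_eq hn hinj hSn p.1.2 q.1.2 ⟨p.2.2.1, h2⟩ ⟨q.2.2.1, hy ▸ h2⟩ he with
          ⟨ht, -⟩ | ⟨ht, ht', -⟩ | ⟨ht, ht', -⟩
        · exact Or.inl ht
        · exact Or.inr (Or.inl ⟨ht, ht'⟩)
        · exact Or.inr (Or.inr ⟨ht, ht'⟩)
    · rintro ⟨hy, h2 | ht | ⟨ht, ht'⟩ | ⟨ht, ht'⟩⟩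
      · rw [← hy, h2, bandPoint_one hn hP p.1.2, bandPoint_one hn hP q.1.2]
      · rw [hy, ht]
      · rw [hy, ht, ht', h01]
      · rw [hy, ht, ht', h01]
  · obtain ⟨d, hd⟩ := hf.surjective ⟨_, hw⟩
    have hdw := hfb d
    rw [hd] at hdw
    rcases d.2.2.2.eq_or_lt with h2 | h2
    · rw [hone _ h2] at hdw
      have := congrFun (congrArg T.coord hdw) w
      rw [coord_vertexPoint, coord_vertexPoint, Pi.single_eq_same] at this
      by_contra hne
      rw [Pi.single_eq_of_ne hne] at this
      exact one_ne_zero this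
    · exact absurd hdw.symm (h.bandMap_ne_vertexPoint hn ⟨d.2.2.1, h2⟩ w)
  · rintro rfl
    have := (f (0, ⟨1, by norm_num⟩)).2
    rwa [hfb, hone _ rfl] at this

end IsStrip

end SurfaceTriangulation

/-! ### The classification of components. -/

theorem theorem2 {M : Type*} [TopologicalSpace M] [T2Space M] [CompactSpace M] [ConnectedSpace M]
    [ChartedSpace (EuclideanSpace ℝ (Fin 2)) M]
    {V : Type*} [Fintype V] [DecidableEq V] (T : SurfaceTriangulation V M)
    (τ : Set (ℤ → Finset V)) (hτ : T.IsZOrientation τ)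
    (hI : ∀ s ∈ T.faces, T.IsFaceI τ s) :
    ∀ C : Set M, IsComponentOf C (T.graphII τ)ᶜ →
      (Nonempty (C ≃ₜ OpenDisk) ∨ Nonempty (C ≃ₜ OpenMobiusStrip) ∨
        Nonempty (C ≃ₜ OpenCylinder)) ∧
      ((∃ v : V, T.IsVertexI τ v ∧ T.vertexPoint v ∈ C) ↔ Nonempty (C ≃ₜ OpenDisk)) ∧
      (∀ v w : V, T.IsVertexI τ v → T.IsVertexI τ w →
        T.vertexPoint v ∈ C → T.vertexPoint w ∈ C → v = w) := by
  rintro _ ⟨x, hx, rfl⟩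
  obtain ⟨s, hs, hxs⟩ := SurfaceTriangulation.exists_face_coord (T := T) x
  obtain ⟨P, Q, S, h, rfl⟩ := SurfaceTriangulation.exists_strip hI hs
  -- Testing the initial face suffices, because a vertex of type I in any face of the walk already
  -- lies in `S 0`.
  by_cases hv : ∃ v ∈ S 0, T.IsVertexI τ v
  · obtain ⟨v, hvS, hv⟩ := hv
    have key : Nonempty (connectedComponentIn (T.graphII τ)ᶜ x ≃ₜ OpenDisk) ∧
        ∀ w, T.vertexPoint w ∈ connectedComponentIn (T.graphII τ)ᶜ x ↔ w = v := by
      rcases h.vertexI_mem hv hvS with ⟨h0, -⟩ | ⟨h0, -⟩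
      · obtain ⟨n, hn, hinj, hSn, hPQ⟩ := h.exists_period
        exact h.component_of_vertexI hn hinj hSn hPQ hv (h.left_eq_of_vertexI hv h0) hx hxs
      · obtain ⟨n, hn, hinj, hSn, hPQ⟩ := h.swap.exists_period
        exact h.swap.component_of_vertexI hn hinj hSn hPQ hv (h.swap.left_eq_of_vertexI hv h0)
          hx hxs
    exact ⟨Or.inl key.1, iff_of_true ⟨v, hv, (key.2 v).2 rfl⟩ key.1,
      fun u w _ _ hu hw => ((key.2 u).1 hu).trans ((key.2 w).1 hw).symm⟩
  · push Not at hv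
    obtain ⟨n, hn, hinj, hSn, hPQ⟩ := h.exists_period
    obtain ⟨hC, hvC⟩ := h.component_of_no_vertexI hn hinj hSn hPQ
      (fun i v hvi hvI => hv v (h.vertexI_mem_zero hvI i hvi) hvI) hx hxs
    refine ⟨Or.inr hC, iff_of_false (fun ⟨v, _, hv⟩ => hvC v hv) ?_,
      fun v _ _ _ hv => absurd hv (hvC v)⟩
    rintro ⟨e⟩
    rcases hC with ⟨⟨g⟩⟩ | ⟨⟨g⟩⟩
    · exact not_nonempty_mobius_homeomorph_disk ⟨g.symm.trans e⟩
    · exact not_nonempty_cylinder_homeomorph_disk ⟨g.symm.trans e⟩
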